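/- **Parameters and signatures.** Let $0\le t<1$, $-1<s\le 0$, and let $u_1,u_2,\dots$ and $v_1,v_2,\dots$ be reals with $0\le u_i<v_j<1$ for all $i,j\ge1$. Let $\mathsf{Sign}^+_N$ be the set of integer sequences $\lambda_1\ge\dots\ge\lambda_N\ge0$ (for $N=0$: only $\varnothing$), and let $m_r(\lambda)=\#\{j:\lambda_j=r\}$. **Local probabilities.** A cross vertex has at most one arrow on each of its edges; its six states are written $ab|cd$, where $a,b,c,d\in\{0,1\}$ are the numbers of arrows on the bottom left, top left, bottom right and top right edges: $00|00$, $10|10$, $01|10$, $01|01$, $10|01$, $11|11$. For $g\in\mathbb{Z}_{\ge0}$ the following tables (row: state before; column: state after; columns in the order just listed) define $P^{\mathrm{fwd}}_{u,v}$ and $P^{\mathrm{bwd}}_{u,v}$. Put $\rho=\frac{u-v}{u-tv}$, $\sigma_u=\frac{(1-t)u}{u-tv}$, $\sigma_v=\frac{(1-t)v}{u-tv}$, $\alpha=\frac{(v-st^g)(1-st^gu)}{(u-st^g)(1-st^gv)}$, $\alpha'=\frac{(u-v)(1-s^2t^{2g})}{(u-st^g)(1-st^gv)}$, $\beta=\frac{(1-t)(1-s^2t^{2g-2})}{(1-t^g)(1-s^2t^{g-1})}$,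 $\beta'=\frac{(t-t^g)(1-s^2t^{g-2})}{(1-t^g)(1-s^2t^{g-1})}$. Here $0^0=1$, $\beta'=0$ for $g=1$, and a fraction with zero denominator is read as $0$ (this concerns only arrow configurations that have probability zero below); negative powers of $t$ at $g=0$ never enter. Forward: - row $00|00$: $1,\ \sigma_v\frac{1-st^gu}{1-st^gv},\ \rho\frac{1-st^{g+1}v}{1-st^gv},\ \sigma_u\frac{1-st^gv}{1-st^gu},\ t\rho\frac{1-st^{g-1}u}{1-st^gu},\ 1$; - row $10|10$: $1,\alpha,\alpha',1,0,1$; - row $01|10$: $1,0,1,\beta,\beta',1$; - row $01|01$: $1,1,0,1,0,1$; - row $10|01$: $1,0,1,0,1,1$; - row $11|11$: $1,\ \sigma_u\frac{v-st^g}{u-st^g},\ \rho\frac{u-st^{g+1}}{u-st^g},\ \sigma_v\frac{u-st^g}{v-st^g},\ t\rho\frac{v-st^{g-1}}{v-st^g},\ 1$. Backward: - row $00|00$: $1,\ \sigma_u\frac{1-st^gv}{1-st^gu},\ \rho\frac{1-st^{g+1}v}{1-st^gv},\ \sigma_v\frac{1-st^gu}{1-st^gv},\ t\rho\frac{1-st^{g-1}u}{1-st^gu},\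 1$; - row $10|10$: $1,1,0,1,0,1$; - row $01|10$: $1,\beta,1,0,\beta',1$; - row $01|01$: $1,1,\alpha',\alpha,0,1$; - row $10|01$: $1,0,1,0,1,1$; - row $11|11$: $1,\ \sigma_v\frac{u-st^g}{v-st^g},\ \rho\frac{u-st^{g+1}}{u-st^g},\ \sigma_u\frac{v-st^g}{u-st^g},\ t\rho\frac{v-st^{g-1}}{v-st^g},\ 1$. **Transition probabilities on signatures.** Let $\kappa,\lambda\in\mathsf{Sign}^+_N$, $\mu,\nu\in\mathsf{Sign}^+_{N+1}$. Call states $c=ab|jj'$ (to the left of column $r$) and $d=ii'|a'b'$ (to the right of column $r$) *admissible* at $r$ if arrows are preserved at both vertices of the column before and after the cross passes: $$m_r(\lambda)+j=m_r(\kappa)+a',\quad m_r(\kappa)+j'=m_r(\mu)+b',\quad m_r(\lambda)+a=m_r(\nu)+i,\quad m_r(\nu)+b=m_r(\mu)+i'.$$ Put $R=\nu_1+1$ and consider sequences of states $c_0=11|11,c_1,\dots,c_R=01|10$ such that $(c_r,c_{r+1})$ is admissible at $r$ for $0\le r<R$. Then $\mathsf U^{\mathrm{fwd}}_{v,u}(\kappa\to\nu\mid\lambda,\mu)$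 is the probability that a cross started in state $11|11$ to the left of column $0$ and dragged to the right through the columns by random forward moves turns the middle signature $\kappa$ into $\nu$ and ends in state $01|10$; that is, $$\mathsf U^{\mathrm{fwd}}_{v,u}(\kappa\to\nu\mid\lambda,\mu)=\sum_{(c_r)}\prod_{r=0}^{R-1}P^{\mathrm{fwd}}_{v,u}(c_r,c_{r+1})\big|_{g=m_r(\kappa)}.$$ Likewise, dragging the cross from state $01|10$ to the right of column $\nu_1$ leftwards to state $11|11$ by backward moves, $$\mathsf U^{\mathrm{bwd}}_{v,u}(\nu\to\kappa\mid\lambda,\mu)=\sum_{(c_r)}\prod_{r=0}^{R-1}P^{\mathrm{bwd}}_{v,u}(c_{r+1},c_r)\big|_{g=m_r(\nu)}.$$ (In both formulas the parameters $u,v$ of the tables are swapped.) **Yang–Baxter field.** This is a random array $\{\boldsymbol\lambda^{(x,y)}\}_{x,y\ge0}$ with $\boldsymbol\lambda^{(x,y)}\in\mathsf{Sign}^+_y$, $\boldsymbol\lambda^{(x,0)}=\varnothing$, $\boldsymbol\lambda^{(0,y)}=(0^y)$ such that for every $n\ge1$, conditionally on $\{\boldsymbol\lambda^{(x',y')}\}_{x'+y'\le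 n}$, the signatures $\boldsymbol\lambda^{(x,y)}$ with $x+y=n+1$, $x,y\ge1$, are independent and $$\mathrm{Prob}\bigl(\boldsymbol\lambda^{(x,y)}=\nu\mid\{\boldsymbol\lambda^{(x',y')}\}_{x'+y'\le n}\bigr)=\mathsf U^{\mathrm{fwd}}_{v_x,u_y}\bigl(\boldsymbol\lambda^{(x-1,y-1)}\to\nu\mid\boldsymbol\lambda^{(x,y-1)},\boldsymbol\lambda^{(x-1,y)}\bigr).$$ **Statement.** For all $x,y\in\mathbb{Z}_{\ge0}$, all $\lambda,\kappa\in\mathsf{Sign}^+_y$ and all $\mu,\nu\in\mathsf{Sign}^+_{y+1}$ such that the event $\{\boldsymbol\lambda^{(x+1,y)}=\lambda,\ \boldsymbol\lambda^{(x,y+1)}=\mu,\ \boldsymbol\lambda^{(x+1,y+1)}=\nu\}$ has positive probability, $$\mathrm{Prob}\bigl(\boldsymbol\lambda^{(x,y)}=\kappa\mid\boldsymbol\lambda^{(x+1,y)}=\lambda,\ \boldsymbol\lambda^{(x,y+1)}=\mu,\ \boldsymbol\lambda^{(x+1,y+1)}=\nu\bigr)=\mathsf U^{\mathrm{bwd}}_{v_{x+1},u_{y+1}}(\nu\to\kappa\mid\lambda,\mu).$$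 -/

import Mathlib

open MeasureTheory ProbabilityTheory

noncomputable section

namespace YangBaxter

/-- Nonnegative signatures `l₁ ≥ l₂ ≥ … ≥ l_N ≥ 0` of length `N`; the part `l_j` of the usual
notation is `l.1 (j-1)`. For `N = 0` there is exactly one, the empty signature. -/
abbrev Sign (N : ℕ) : Type := {l : Fin N → ℕ // Antitone l}

/-- The signature `(0^N)`. -/
def Sign.zero (N : ℕ) : Sign N := ⟨fun _ => 0, antitone_const⟩

/-- The number of parts of `l` equal to `r`, that is, the number of vertical arrows at site `r`
in the arrow configuration encoded by `l`. -/
def Sign.mult {N : ℕ} (l : Sign N) (r : ℕ) : ℕ := (Finset.univ.filter fun j => l.1 j = r).card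

/-- The six states of a cross vertex. The letters tell whether there is an arrow (`i`) or not (`o`)
on the edges bottom left, top left, bottom right, top right, in this order. -/
inductive CrossState : Type
  | oooo | ioio | oiio | oioi | iooi | iiii
  deriving DecidableEq

namespace CrossState

instance : Fintype CrossState where
  elems := {oooo, ioio, oiio, oioi, iooi, iiii}
  complete := by intro c; cases c <;> decide

/-- Number of arrows on the bottom left edge of the cross vertex. -/
def leftBot : CrossState → ℕ
  | oooo => 0 | ioio => 1 | oiio => 0 | oioi => 0 | iooi => 1 | iiii => 1

/-- Number of arrows on the top left edge of the cross vertex. -/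
def leftTop : CrossState → ℕ
  | oooo => 0 | ioio => 0 | oiio => 1 | oioi => 1 | iooi => 0 | iiii => 1

/-- Number of arrows on the bottom right edge of the cross vertex. -/
def rightBot : CrossState → ℕ
  | oooo => 0 | ioio => 1 | oiio => 1 | oioi => 0 | iooi => 0 | iiii => 1

/-- Number of arrows on the top right edge of the cross vertex. -/
def rightTop : CrossState → ℕ
  | oooo => 0 | ioio => 0 | oiio => 0 | oioi => 1 | iooi => 1 | iiii => 1

end CrossState

open CrossState

/-- The local forward probability `P^fwd_{u,v}`: the cross vertex in the first state stands to the
left of a column and is moved to the right of it, where it gets the second state; `g` is the number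
of vertical arrows in the middle of the column before the move. In the entries with `g - 1` (`g - 2`)
an arrow configuration with these states has `g ≥ 1` (and, for `g = 1`, the factor `t - t ^ g`
vanishes), so that the truncated subtraction in the exponents is harmless. -/
def fwdProb (t s u v : ℝ) (g : ℕ) : CrossState → CrossState → ℝ
  | oooo, oooo => 1
  | oooo, ioio => (1 - t) * v / (u - t * v) * ((1 - s * t ^ g * u) / (1 - s * t ^ g * v))
  | oooo, oiio => (u - v) / (u - t * v) * ((1 - s * t ^ (g + 1) * v) / (1 - s * t ^ g * v))
  | oooo, oioi => (1 - t) * u / (u - t * v) * ((1 - s * t ^ g * v) / (1 - s * t ^ g * u))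
  | oooo, iooi => t * (u - v) / (u - t * v) * ((1 - s * t ^ (g - 1) * u) / (1 - s * t ^ g * u))
  | oooo, iiii => 1
  | ioio, oooo => 1
  | ioio, ioio => (v - s * t ^ g) / (u - s * t ^ g) * ((1 - s * t ^ g * u) / (1 - s * t ^ g * v))
  | ioio, oiio => (u - v) / (u - s * t ^ g) * ((1 - s ^ 2 * t ^ (2 * g)) / (1 - s * t ^ g * v))
  | ioio, oioi => 1
  | ioio, iooi => 0
  | ioio, iiii => 1
  | oiio, oooo => 1
  | oiio, ioio => 0
  | oiio, oiio => 1
  | oiio, oioi =>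
      (1 - t) / (1 - t ^ g) * ((1 - s ^ 2 * t ^ (2 * g - 2)) / (1 - s ^ 2 * t ^ (g - 1)))
  | oiio, iooi =>
      (t - t ^ g) / (1 - t ^ g) * ((1 - s ^ 2 * t ^ (g - 2)) / (1 - s ^ 2 * t ^ (g - 1)))
  | oiio, iiii => 1
  | oioi, oooo => 1
  | oioi, ioio => 1
  | oioi, oiio => 0
  | oioi, oioi => 1
  | oioi, iooi => 0
  | oioi, iiii => 1
  | iooi, oooo => 1
  | iooi, ioio => 0
  | iooi, oiio => 1
  | iooi, oioi => 0
  | iooi, iooi => 1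
  | iooi, iiii => 1
  | iiii, oooo => 1
  | iiii, ioio => (1 - t) * u / (u - t * v) * ((v - s * t ^ g) / (u - s * t ^ g))
  | iiii, oiio => (u - v) / (u - t * v) * ((u - s * t ^ (g + 1)) / (u - s * t ^ g))
  | iiii, oioi => (1 - t) * v / (u - t * v) * ((u - s * t ^ g) / (v - s * t ^ g))
  | iiii, iooi => t * (u - v) / (u - t * v) * ((v - s * t ^ (g - 1)) / (v - s * t ^ g))
  | iiii, iiii => 1

/-- The local backward probability `P^bwd_{u,v}`: the cross vertex in the first state stands to the
right of a column and is moved to the left of it, where it gets the second state; `g` is the number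
of vertical arrows in the middle of the column before the move. The remark on exponents at
`fwdProb` applies here too. -/
def bwdProb (t s u v : ℝ) (g : ℕ) : CrossState → CrossState → ℝ
  | oooo, oooo => 1
  | oooo, ioio => (1 - t) * u / (u - t * v) * ((1 - s * t ^ g * v) / (1 - s * t ^ g * u))
  | oooo, oiio => (u - v) / (u - t * v) * ((1 - s * t ^ (g + 1) * v) / (1 - s * t ^ g * v))
  | oooo, oioi => (1 - t) * v / (u - t * v) * ((1 - s * t ^ g * u) / (1 - s * t ^ g * v))
  | oooo, iooi => t * (u - v) / (u - t * v) * ((1 - s * t ^ (g - 1) * u) / (1 - s * t ^ g * u))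
  | oooo, iiii => 1
  | ioio, oooo => 1
  | ioio, ioio => 1
  | ioio, oiio => 0
  | ioio, oioi => 1
  | ioio, iooi => 0
  | ioio, iiii => 1
  | oiio, oooo => 1
  | oiio, ioio =>
      (1 - t) / (1 - t ^ g) * ((1 - s ^ 2 * t ^ (2 * g - 2)) / (1 - s ^ 2 * t ^ (g - 1)))
  | oiio, oiio => 1
  | oiio, oioi => 0
  | oiio, iooi =>
      (t - t ^ g) / (1 - t ^ g) * ((1 - s ^ 2 * t ^ (g - 2)) / (1 - s ^ 2 * t ^ (g - 1)))
  | oiio, iiii => 1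
  | oioi, oooo => 1
  | oioi, ioio => 1
  | oioi, oiio => (u - v) / (u - s * t ^ g) * ((1 - s ^ 2 * t ^ (2 * g)) / (1 - s * t ^ g * v))
  | oioi, oioi => (v - s * t ^ g) / (u - s * t ^ g) * ((1 - s * t ^ g * u) / (1 - s * t ^ g * v))
  | oioi, iooi => 0
  | oioi, iiii => 1
  | iooi, oooo => 1
  | iooi, ioio => 0
  | iooi, oiio => 1
  | iooi, oioi => 0
  | iooi, iooi => 1
  | iooi, iiii => 1
  | iiii, oooo => 1
  | iiii, ioio => (1 - t) * v / (u - t * v) * ((u - s * t ^ g) / (v - s * t ^ g))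
  | iiii, oiio => (u - v) / (u - t * v) * ((u - s * t ^ (g + 1)) / (u - s * t ^ g))
  | iiii, oioi => (1 - t) * u / (u - t * v) * ((v - s * t ^ g) / (u - s * t ^ g))
  | iiii, iooi => t * (u - v) / (u - t * v) * ((v - s * t ^ (g - 1)) / (v - s * t ^ g))
  | iiii, iiii => 1

/-- Arrow preservation at the two vertices of one column, with `l` vertical arrows entering at the
bottom and `m` leaving at the top: the cross vertex `c` on the left of the column goes with `k`
vertical arrows in the middle, the cross vertex `d` on its right goes with `n`, and the two
three-vertex configurations have the same boundary conditions (on the left those of `c`, on the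
right those of `d`). -/
abbrev Preserved (l k n m : ℕ) (c d : CrossState) : Prop :=
  (l + c.rightBot = k + d.rightBot ∧ k + c.rightTop = m + d.rightTop) ∧
    (l + c.leftBot = n + d.leftBot ∧ n + c.leftTop = m + d.leftTop)

/-- Take the two-layer arrow configuration with `lam`, `kap`, `mu` from bottom to top, put the cross
vertex `iiii` to the left of column `0`, and drag it to the right by random forward moves with the
local probabilities `P^fwd_{v,u}`. `fwdDrag t s v u lam kap mu nu r d` is the probability that after
passing the columns `0, …, r - 1` the cross vertex has the state `d` and the numbers of arrows in the
middle of these columns are those of `nu`. -/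
def fwdDrag (t s v u : ℝ) {N : ℕ} (lam kap : Sign N) (mu nu : Sign (N + 1)) :
    ℕ → CrossState → ℝ
  | 0, d => if d = iiii then 1 else 0
  | r + 1, d => ∑ c : CrossState,
      if Preserved (lam.mult r) (kap.mult r) (nu.mult r) (mu.mult r) c d then
        fwdDrag t s v u lam kap mu nu r c * fwdProb t s v u (kap.mult r) c d
      else 0

/-- The forward transition probability `U^fwd_{v,u}(kap → nu ∣ lam, mu)`: the middle signature turns
into `nu` and the cross vertex has reached its final state `oiio` after the column of the largest part
of `nu`; this state is never left and creates no further arrows. -/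
def Ufwd (t s v u : ℝ) {N : ℕ} (kap : Sign N) (nu : Sign (N + 1)) (lam : Sign N)
    (mu : Sign (N + 1)) : ℝ :=
  fwdDrag t s v u lam kap mu nu (nu.1 0 + 1) oiio

/-- Take the two-layer arrow configuration with `lam`, `nu`, `mu` from bottom to top, put the cross
vertex in the state `d` between the columns `r - 1` and `r`, and drag it to the left by random backward
moves with the local probabilities `P^bwd_{v,u}` through the columns `r - 1, …, 0`.
`bwdDrag t s v u lam nu mu kap r d` is the probability that the numbers of arrows in the middle of these
columns become those of `kap` and the cross vertex arrives in the state `iiii`. -/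
def bwdDrag (t s v u : ℝ) {N : ℕ} (lam : Sign N) (nu mu : Sign (N + 1)) (kap : Sign N) :
    ℕ → CrossState → ℝ
  | 0, d => if d = iiii then 1 else 0
  | r + 1, d => ∑ c : CrossState,
      if Preserved (lam.mult r) (kap.mult r) (nu.mult r) (mu.mult r) c d then
        bwdProb t s v u (nu.mult r) d c * bwdDrag t s v u lam nu mu kap r c
      else 0

/-- The backward transition probability `U^bwd_{v,u}(nu → kap ∣ lam, mu)`: the cross vertex starts in
the state `oiio` right after the column of the largest part of `nu`. -/
def Ubwd (t s v u : ℝ) {N : ℕ} (nu : Sign (N + 1)) (kap : Sign N) (lam : Sign N)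
    (mu : Sign (N + 1)) : ℝ :=
  bwdDrag t s v u lam nu mu kap (nu.1 0 + 1) oiio

/-- `Λ` is a Yang-Baxter field under `P`: a random array of nonnegative signatures, `Λ x y` of length
`y`, equal to `(0^y)` for `x = 0` (and to the empty signature for `y = 0`, by its type), such that,
for every `n ≥ 1` (here `n = m + 1`), given all signatures at `x + y ≤ n`, the ones at `x + y = n + 1`
with `x, y ≥ 1` (here `(x, y) = (p.1 + 1, p.2 + 1)`) are independent with the laws
`U^fwd_{v_x,u_y}(Λ^{(x-1,y-1)} → · ∣ Λ^{(x,y-1)}, Λ^{(x-1,y)})`, that is, the joint law of every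
subfamily of them is the product of these laws.
The spectral parameters are `u 1, u 2, …` and `v 1, v 2, …`. -/
structure IsYangBaxterField (t s : ℝ) (u v : ℕ → ℝ) {Ω : Type*} [MeasurableSpace Ω]
    (P : Measure Ω) (Λ : (x y : ℕ) → Ω → Sign y) : Prop where
  measurable : ∀ x y, Measurable (Λ x y)
  boundary : ∀ y, ∀ᵐ ω ∂P, Λ 0 y ω = Sign.zero y
  step : ∀ (m : ℕ) (a : (x y : ℕ) → Sign y),
    P {ω | ∀ x y, x + y ≤ m + 1 → Λ x y ω = a x y} ≠ 0 →
    ∀ S ⊆ Finset.HasAntidiagonal.antidiagonal m,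
      (P[|{ω | ∀ x y, x + y ≤ m + 1 → Λ x y ω = a x y}]).real
          {ω | ∀ p ∈ S, Λ (p.1 + 1) (p.2 + 1) ω = a (p.1 + 1) (p.2 + 1)} =
        ∏ p ∈ S,
          Ufwd t s (v (p.1 + 1)) (u (p.2 + 1)) (a p.1 p.2) (a (p.1 + 1) (p.2 + 1))
            (a (p.1 + 1) p.2) (a p.1 (p.2 + 1))

end YangBaxter

end

noncomputable section

namespace YangBaxter

open CrossState

/-! The two tables of local probabilities form a reversible coupling of the two sides of the
Yang–Baxter equation. The weight of a cross and two vertices before a move, times the forward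
probability, equals the weight after the move times the backward probability
(`local_reversibility`). Multiplying over the columns gives the same relation for whole rows
(`weight_mul_Ufwd`). For a square with lower left corner `kap`, upper right corner `nu` and other
corners `lam`, `mu`, the weight of the two rows meeting at `kap`, times `Ufwd`, is a constant times
the weight of the two rows meeting at `nu`, times `Ubwd`.

The backward probabilities sum to one over `kap` unless the weight at `nu` is zero (`sum_Ubwd`).
Hence adding the next antidiagonal by forward moves and forgetting the lowest one turns a product of
lower corner weights into a product of upper corner weights. These regroup into the lower corner
weights of the next antidiagonal. By induction the field on two consecutive antidiagonals has a law
proportional to a product of row weights (`staircase_law`).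

In that law `kap` enters only through the weight of its own square. After one more forward step,
reversibility leaves a joint law whose sole dependence on `kap` is the factor `Ubwd` (`joint_law`).
Summing over `kap` identifies the other factor, and summing over the rest of the staircase gives the
conditional law. -/

/-! ### Local weights and local moves of the cross vertex. -/

/-- The spin Hall-Littlewood vertex weight (up to normalization): `l` vertical arrows enter, `j`
horizontal arrows enter, `k` vertical arrows leave, `j'` horizontal arrows leave. -/
def vertexWeight (t s x : ℝ) (l j k j' : ℕ) : ℝ :=
  if j = 0 then (if j' = 0 then 1 - s * t ^ l * x else (1 - s ^ 2 * t ^ k) * x)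
  else (if j' = 0 then 1 - t ^ k else x - s * t ^ l)

/-- The weight of a cross vertex. -/
def crossWeight (t a b : ℝ) : CrossState → ℝ
  | oooo => 1
  | ioio => (1 - t) * a / (a - t * b)
  | oiio => (a - b) / (a - t * b)
  | oioi => (1 - t) * b / (a - t * b)
  | iooi => t * (a - b) / (a - t * b)
  | iiii => 1

theorem sq_mul_pow_lt_one {t s : ℝ} (ht0 : 0 ≤ t) (ht1 : t < 1) (hs0 : -1 < s) (hs1 : s ≤ 0)
    (n : ℕ) : s ^ 2 * t ^ n < 1 := by
  have h1 : t ^ n ≤ 1 := pow_le_one₀ ht0 ht1.le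
  have h2 : 0 ≤ t ^ n := pow_nonneg ht0 n
  nlinarith [sq_nonneg s]

set_option maxHeartbeats 4000000 in
/-- The two local drags are reversible with respect to the weights of the three vertices. -/
theorem local_reversibility {t s a b : ℝ} (ht0 : 0 ≤ t) (ht1 : t < 1) (hs0 : -1 < s) (hs1 : s ≤ 0)
    (hb : 0 ≤ b) (hab : b < a) {l k n m : ℕ} {c d : CrossState} (h : Preserved l k n m c d) :
    crossWeight t a b c * (vertexWeight t s a l c.rightBot k d.rightBot *
        vertexWeight t s b k c.rightTop m d.rightTop) * fwdProb t s a b k c d =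
      crossWeight t a b d * (vertexWeight t s b l c.leftBot n d.leftBot *
        vertexWeight t s a n c.leftTop m d.leftTop) * bwdProb t s a b n d c := by
  have hden : a - t * b ≠ 0 := by nlinarith
  have hst : ∀ g : ℕ, s * t ^ g ≤ 0 := fun g => mul_nonpos_of_nonpos_of_nonneg hs1 (pow_nonneg ht0 g)
  have ha1 : ∀ g : ℕ, 1 - s * t ^ g * a ≠ 0 := fun g => by nlinarith [hst g]
  have hb1 : ∀ g : ℕ, 1 - s * t ^ g * b ≠ 0 := fun g => by nlinarith [hst g]
  have ha2 : ∀ g : ℕ, a - s * t ^ g ≠ 0 := fun g => by nlinarith [hst g]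
  have hs2 : ∀ g : ℕ, 1 - s ^ 2 * t ^ g ≠ 0 := fun g => by
    have := sq_mul_pow_lt_one ht0 ht1 hs0 hs1 g; linarith
  have ht : ∀ g : ℕ, 1 - t ^ (g + 1) ≠ 0 := fun g => by
    have := pow_lt_one₀ ht0 ht1 g.add_one_ne_zero; linarith
  have hb2 : ∀ g : ℕ, b - s * t ^ g = 0 → b = 0 ∧ s * t ^ g = 0 := fun g hg => by
    have := hst g; constructor <;> linarith
  obtain ⟨⟨h1, h2⟩, h3, h4⟩ := h
  cases c <;> cases d <;>
    simp only [leftBot, leftTop, rightBot, rightTop] at h1 h2 h3 h4 <;> try omega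
  all_goals
    -- Preservation keeps the four occupation numbers within two of their minimum, which leaves
    -- finitely many explicit cases in the single variable `g`.
    obtain ⟨g, hg⟩ : ∃ g, g = min (min l k) (min n m) := ⟨_, rfl⟩
    have el : g = l ∨ g + 1 = l ∨ g + 2 = l := by omega
    have ek : g = k ∨ g + 1 = k ∨ g + 2 = k := by omega
    have en : g = n ∨ g + 1 = n ∨ g + 2 = n := by omega
    have em : g = m ∨ g + 1 = m ∨ g + 2 = m := by omega
    rcases el with el | el | el <;> try omega
    all_goals rcases ek with ek | ek | ek <;> try omega
    all_goals rcases en with en | en | en <;> try omega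
    all_goals rcases em with em | em | em <;> try omega
  all_goals subst el ek en em
  all_goals clear hg h1 h2 h3 h4
  all_goals
    simp only [vertexWeight, crossWeight, fwdProb, bwdProb, leftBot, leftTop, rightBot, rightTop,
      if_true, if_false, one_ne_zero, Nat.add_sub_cancel]
  all_goals
    have e1 : t - t ^ (g + 2) = t * (1 - t ^ (g + 1)) := by ring
    have e2 : 2 * (g + 1) - 2 = 2 * g := by omega
    have e3 : g + 2 - 1 = g + 1 := by omega
    try simp only [e1, e2, e3]
    clear e1 e2 e3
    have a0 := ha1 g
    have a1 := ha1 (g + 1)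
    have b0 := hb1 g
    have b1 := hb1 (g + 1)
    have c0 := ha2 g
    have c1 := ha2 (g + 1)
    have d0 := hs2 g
    have d1 := hs2 (g + 1)
    have f0 := ht g
    have f1 := ht (g + 1)
    -- This is the only denominator that can vanish. Where it occurs, the table entry is read as
    -- zero, and the other side then has a factor `b` or `t * (b - s * t ^ g)`, which is zero as
    -- well.
    have j1 : b - s * t ^ (g + 1) = 0 → b = 0 ∧ (t = 0 ∨ b - s * t ^ g = 0) := fun hj => by
      obtain ⟨h0, h1⟩ := hb2 _ hj
      refine ⟨h0, ?_⟩
      rw [← mul_eq_zero, h0]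
      linear_combination -h1
    rw [show g + 1 + 1 = g + 2 from rfl] at f1
    clear ha1 hb1 ha2 hs2 ht hb2 hst ht0 ht1 hs0 hs1 hb hab
    -- With the recurring factors named, each remaining identity is a cancellation of common
    -- factors, so their inner structure can be forgotten.
    generalize a - t * b = D at *
    generalize a - b = D' at *
    generalize 1 - s * t ^ g * a = A0 at *
    generalize 1 - s * t ^ (g + 1) * a = A1 at *
    generalize 1 - s * t ^ g * b = B0 at *
    generalize 1 - s * t ^ (g + 1) * b = B1 at *
    generalize a - s * t ^ g = C0 at *
    generalize a - s * t ^ (g + 1) = C1 at *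
    generalize b - s * t ^ g = E0 at *
    generalize b - s * t ^ (g + 1) = E1 at *
    generalize 1 - s ^ 2 * t ^ g = S0 at *
    generalize 1 - s ^ 2 * t ^ (g + 1) = S1 at *
    generalize 1 - s ^ 2 * t ^ (2 * g) = S2 at *
    generalize 1 - t ^ (g + 1) = T1 at *
    generalize 1 - t ^ (g + 2) = T2 at *
  all_goals
    by_cases hj : E1 = 0
    · obtain ⟨h0, h1 | h1⟩ := j1 hj
      · field_simp; try simp [hj, h0, h1]
      · field_simp; try simp [hj, h0, h1]
    · field_simp; try simp

theorem sum_crossState {β : Type*} [AddCommMonoid β] (f : CrossState → β) :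
    ∑ c, f c = f oooo + (f ioio + (f oiio + (f oioi + (f iooi + f iiii)))) := by
  rw [show (Finset.univ : Finset CrossState) = {oooo, ioio, oiio, oioi, iooi, iiii} from rfl]
  repeat rw [Finset.sum_insert (by decide)]
  rw [Finset.sum_singleton]

/-- Preservation at the bottom vertex forces `k = l + c.rightBot - d.rightBot`, so the sum has at
most one term; `M` only has to exceed `l + 1`. -/
theorem sum_preserved_middle {l n m M : ℕ} (hM : l + 1 < M) (c d : CrossState) (x : ℝ) :
    ∑ k ∈ Finset.range M, (if Preserved l k n m c d then x else 0) =
      if (d.rightBot ≤ l + c.rightBot ∧ l + c.rightBot + c.rightTop = m + d.rightTop + d.rightBot) ∧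
        (l + c.leftBot = n + d.leftBot ∧ n + c.leftTop = m + d.leftTop) then x else 0 := by
  have hc : c.rightBot ≤ 1 := by cases c <;> decide
  rw [Finset.sum_eq_single (l + c.rightBot - d.rightBot)]
  · refine if_congr ?_ rfl rfl
    constructor
    · rintro ⟨⟨h1, h2⟩, h3, h4⟩
      omega
    · rintro ⟨⟨h1, h2⟩, h3, h4⟩
      refine ⟨⟨?_, ?_⟩, h3, h4⟩ <;> omega
  · rintro k - hk
    rw [if_neg]
    rintro ⟨⟨h1, h2⟩, h3, h4⟩
    omega
  · intro h
    exact absurd (Finset.mem_range.2 (by omega)) h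

theorem bwdProb_row_sum_oiio {t s : ℝ} (ht0 : 0 ≤ t) (ht1 : t < 1) (hs0 : -1 < s) (hs1 : s ≤ 0)
    (a b : ℝ) (g : ℕ) :
    bwdProb t s a b (g + 1) oiio ioio + bwdProb t s a b (g + 1) oiio iooi = 1 := by
  have h1 : 1 - s ^ 2 * t ^ g ≠ 0 := by
    have := sq_mul_pow_lt_one ht0 ht1 hs0 hs1 g; linarith
  have h2 : 1 - t ^ (g + 1) ≠ 0 := by
    have := pow_lt_one₀ ht0 ht1 g.add_one_ne_zero; linarith
  simp only [bwdProb, show 2 * (g + 1) - 2 = 2 * g by omega, Nat.add_sub_cancel]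
  rw [div_mul_div_comm, div_mul_div_comm, ← add_div, div_eq_one_iff_eq (mul_ne_zero h2 h1)]
  -- For `g = 0` the exponent `g + 1 - 2` is truncated, but its term carries the factor `t - t ^ 1 =
  -- 0`.
  rcases g with _ | g
  · ring
  · rw [show g + 1 + 1 - 2 = g by omega]; ring

/-- Preservation for the configuration after the cross forces the left edges of `c` to carry `jB`
and `jT` arrows. Hence at most two states compete, and their table entries add up to one. The
hypothesis `hw` excludes the vanishing of `b - s * t ^ n`, where the table would read a fraction as
zero and the row would lose mass. -/
theorem bwdProb_column_sum {t s a b : ℝ} (ht0 : 0 ≤ t) (ht1 : t < 1) (hs0 : -1 < s) (hs1 : s ≤ 0)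
    (hb : 0 ≤ b) (hab : b < a) {l n m jB jT M : ℕ} {d : CrossState} (hM : l + 1 < M)
    (hB : l + jB = n + d.leftBot) (hT : n + jT = m + d.leftTop) (hjB : jB ≤ 1) (hjT : jT ≤ 1)
    (hw : vertexWeight t s b l jB n d.leftBot ≠ 0) :
    ∑ k ∈ Finset.range M, ∑ c, (if Preserved l k n m c d then bwdProb t s a b n d c else 0) = 1 := by
  have hden : a - t * b ≠ 0 := by nlinarith
  have hst : ∀ g : ℕ, s * t ^ g ≤ 0 := fun g => mul_nonpos_of_nonpos_of_nonneg hs1 (pow_nonneg ht0 g)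
  have ha1 : ∀ g : ℕ, 1 - s * t ^ g * a ≠ 0 := fun g => by nlinarith [hst g]
  have hb1 : ∀ g : ℕ, 1 - s * t ^ g * b ≠ 0 := fun g => by nlinarith [hst g]
  have ha2 : ∀ g : ℕ, a - s * t ^ g ≠ 0 := fun g => by nlinarith [hst g]
  have hoiio := bwdProb_row_sum_oiio ht0 ht1 hs0 hs1 a b
  rw [Finset.sum_comm]
  simp_rw [sum_preserved_middle hM]
  rw [sum_crossState]
  interval_cases jB <;> interval_cases jT <;> cases d <;>
    simp only [leftBot, leftTop, rightBot, rightTop, add_zero] at hB hT hw ⊢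
  all_goals
    obtain ⟨g, hg⟩ : ∃ g, g = min l (min n m) := ⟨_, rfl⟩
    have el : g = l ∨ g + 1 = l ∨ g + 2 = l := by omega
    have en : g = n ∨ g + 1 = n ∨ g + 2 = n := by omega
    have em : g = m ∨ g + 1 = m ∨ g + 2 = m := by omega
    rcases el with el | el | el <;> try omega
    all_goals rcases en with en | en | en <;> try omega
    all_goals rcases em with em | em | em <;> try omega
  all_goals subst el en em
  all_goals clear hg hB hT hM
  all_goals simp
  all_goals try (simp [bwdProb]; done)
  all_goals try
    (simp only [bwdProb, Nat.add_sub_cancel]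
     rw [div_mul_div_comm, div_mul_div_comm, ← add_div, div_eq_one_iff_eq (by
      first
        | exact mul_ne_zero hden (ha1 _)
        | exact mul_ne_zero hden (hb1 _)
        | exact mul_ne_zero hden (ha2 _)
        | exact mul_ne_zero (ha2 _) (hb1 _)
        | exact mul_ne_zero hden (by simpa [vertexWeight] using hw))]
     ring)
  all_goals
    rcases g with _ | g
    · simpa [bwdProb] using hoiio 0
    · simpa [bwdProb] using hoiio (g + 1)

/-! ### Multiplicities and the size of the parts. -/

theorem Sign.mult_le {N : ℕ} (l : Sign N) (r : ℕ) : l.mult r ≤ N := by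
  simpa [Sign.mult] using Finset.card_filter_le (Finset.univ : Finset (Fin N)) fun j => l.1 j = r

theorem Sign.sum_mult {N : ℕ} (l : Sign N) (R : ℕ) :
    ∑ r ∈ Finset.range R, l.mult r = (Finset.univ.filter fun j => l.1 j < R).card := by
  rw [Finset.card_eq_sum_card_fiberwise (f := l.1) (t := Finset.range R)]
  · refine Finset.sum_congr rfl fun r hr => ?_
    rw [Sign.mult, Finset.filter_filter]
    congr 1
    ext j
    simp only [Finset.mem_filter, Finset.mem_univ, true_and]
    rw [Finset.mem_range] at hr
    omega
  · intro j hj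
    simpa using hj

theorem Sign.sum_mult_eq_iff {N : ℕ} (l : Sign N) (R : ℕ) :
    ∑ r ∈ Finset.range R, l.mult r = N ↔ ∀ j, l.1 j < R := by
  rw [Sign.sum_mult]
  have := Finset.card_filter_eq_iff (s := (Finset.univ : Finset (Fin N))) (p := fun j => l.1 j < R)
  simpa using this

theorem Sign.mult_eq_zero {N : ℕ} {l : Sign N} {R r : ℕ} (h : ∀ j, l.1 j < R) (hr : R ≤ r) :
    l.mult r = 0 := by
  rw [Sign.mult, Finset.card_eq_zero, Finset.filter_eq_empty_iff]
  intro j _ hj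
  have := h j
  omega

theorem Sign.lt_first_add_one {N : ℕ} (l : Sign (N + 1)) (j : Fin (N + 1)) : l.1 j < l.1 0 + 1 :=
  Nat.lt_succ_of_le (l.2 (Fin.zero_le j))

/-! ### Weights of a row of vertices. -/

/-- The weight of the first `r` columns of a row of vertices with the vertical arrows `al` at the
bottom and `be` at the top, with an arrow entering at the left and `j` arrows leaving at the right;
every vertex weight is multiplied by `z`. -/
def rowWeight (t s x z : ℝ) (al be : ℕ → ℕ) : ℕ → ℕ → ℝ
  | 0, j => if j = 1 then 1 else 0
  | r + 1, j' => ∑ j ∈ Finset.range 2,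
      if al r + j = be r + j' then
        rowWeight t s x z al be r j * (z * vertexWeight t s x (al r) j (be r) j')
      else 0

section Row

variable {t s x z : ℝ} {al be : ℕ → ℕ}

/-- Arrow preservation determines the number of arrows on the edge between two columns, so the
recursive sum has a single term. -/
theorem rowWeight_succ {r j j' : ℕ} (hj : j ≤ 1) (h : al r + j = be r + j') :
    rowWeight t s x z al be (r + 1) j' =
      rowWeight t s x z al be r j * (z * vertexWeight t s x (al r) j (be r) j') := by
  rw [rowWeight, Finset.sum_eq_single j]
  · rw [if_pos h]
  · intro i _ hi
    rw [if_neg]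
    omega
  · intro hn
    exact absurd (Finset.mem_range.2 (by omega)) hn

theorem exists_of_rowWeight_ne_zero {r j' : ℕ} (h : rowWeight t s x z al be (r + 1) j' ≠ 0) :
    ∃ j ≤ 1, al r + j = be r + j' ∧ rowWeight t s x z al be r j ≠ 0 ∧
      vertexWeight t s x (al r) j (be r) j' ≠ 0 := by
  rw [rowWeight] at h
  obtain ⟨j, hj, hne⟩ := Finset.exists_ne_zero_of_sum_ne_zero h
  rw [Finset.mem_range] at hj
  split_ifs at hne with hc
  · exact ⟨j, by omega, hc, left_ne_zero_of_mul hne,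
      right_ne_zero_of_mul (right_ne_zero_of_mul hne)⟩
  · exact absurd rfl hne

theorem rowWeight_stable {R r j : ℕ} (hj : j ≤ 1) (hz : z * vertexWeight t s x 0 j 0 j = 1)
    (hal : ∀ i, R ≤ i → al i = 0) (hbe : ∀ i, R ≤ i → be i = 0) (hr : R ≤ r) :
    rowWeight t s x z al be r j = rowWeight t s x z al be R j := by
  induction r, hr using Nat.le_induction with
  | base => rfl
  | succ r hr ih =>
    rw [rowWeight_succ hj (by rw [hal r hr, hbe r hr]), ih, hal r hr, hbe r hr, hz, mul_one]

end Row

/-! ### Dragging the cross vertex through a whole row. -/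

section Drag

variable {t s a b : ℝ} {N : ℕ} {lam kap : Sign N} {mu nu : Sign (N + 1)}

/-- The global form of `local_reversibility`. -/
theorem drag_reversibility (ht0 : 0 ≤ t) (ht1 : t < 1) (hs0 : -1 < s) (hs1 : s ≤ 0)
    (hb : 0 ≤ b) (hab : b < a) (z z' : ℝ) (r : ℕ) (d : CrossState) :
    fwdDrag t s a b lam kap mu nu r d *
        (rowWeight t s a z lam.mult kap.mult r d.rightBot *
          rowWeight t s b z' kap.mult mu.mult r d.rightTop) =
      bwdDrag t s a b lam nu mu kap r d * (crossWeight t a b d *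
        (rowWeight t s b z' lam.mult nu.mult r d.leftBot *
          rowWeight t s a z nu.mult mu.mult r d.leftTop)) := by
  induction r generalizing d with
  | zero =>
    by_cases hd : d = iiii
    · subst hd
      simp [fwdDrag, bwdDrag, rowWeight, crossWeight, leftBot, leftTop, rightBot, rightTop]
    · simp [fwdDrag, bwdDrag, hd]
  | succ r ih =>
    rw [fwdDrag, bwdDrag, Finset.sum_mul, Finset.sum_mul]
    refine Finset.sum_congr rfl fun c _ => ?_
    by_cases h : Preserved (lam.mult r) (kap.mult r) (nu.mult r) (mu.mult r) c d
    · have hloc := local_reversibility ht0 ht1 hs0 hs1 hb hab h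
      have hc := ih c
      rw [if_pos h, if_pos h]
      obtain ⟨⟨h1, h2⟩, h3, h4⟩ := h
      rw [rowWeight_succ (by cases c <;> decide) h1, rowWeight_succ (by cases c <;> decide) h2,
        rowWeight_succ (by cases c <;> decide) h3, rowWeight_succ (by cases c <;> decide) h4]
      generalize rowWeight t s a z lam.mult kap.mult r c.rightBot = A at *
      generalize rowWeight t s b z' kap.mult mu.mult r c.rightTop = B at *
      generalize rowWeight t s b z' lam.mult nu.mult r c.leftBot = C at *
      generalize rowWeight t s a z nu.mult mu.mult r c.leftTop = D at *
      generalize vertexWeight t s a (lam.mult r) c.rightBot (kap.mult r) d.rightBot = w1 at *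
      generalize vertexWeight t s b (kap.mult r) c.rightTop (mu.mult r) d.rightTop = w2 at *
      generalize vertexWeight t s b (lam.mult r) c.leftBot (nu.mult r) d.leftBot = w3 at *
      generalize vertexWeight t s a (nu.mult r) c.leftTop (mu.mult r) d.leftTop = w4 at *
      -- The first multiple moves the cross through the earlier columns, the second through column
      -- `r`. The intermediate expression carries the weight of `c` once and cancels.
      linear_combination (z * z' * fwdProb t s a b (kap.mult r) c d * w1 * w2) * hc +
        z * z' * bwdDrag t s a b lam nu mu kap r c * C * D * hloc
    · rw [if_neg h, if_neg h, zero_mul, zero_mul]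

theorem fwdDrag_succ_ne_zero {r : ℕ} {d : CrossState}
    (h : fwdDrag t s a b lam kap mu nu (r + 1) d ≠ 0) :
    ∃ c, Preserved (lam.mult r) (kap.mult r) (nu.mult r) (mu.mult r) c d ∧
      fwdDrag t s a b lam kap mu nu r c ≠ 0 := by
  rw [fwdDrag] at h
  obtain ⟨c, -, hne⟩ := Finset.exists_ne_zero_of_sum_ne_zero h
  split_ifs at hne with hc
  · exact ⟨c, hc, left_ne_zero_of_mul hne⟩
  · exact absurd rfl hne

/-- The probability of the backward drag in terms of the multiplicities of the signatures. -/
def bwdDragMult (t s a b : ℝ) (l n m k : ℕ → ℕ) : ℕ → CrossState → ℝ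
  | 0, d => if d = iiii then 1 else 0
  | r + 1, d => ∑ c : CrossState,
      if Preserved (l r) (k r) (n r) (m r) c d then
        bwdProb t s a b (n r) d c * bwdDragMult t s a b l n m k r c
      else 0

theorem bwdDrag_eq (r : ℕ) (d : CrossState) :
    bwdDrag t s a b lam nu mu kap r d =
      bwdDragMult t s a b lam.mult nu.mult mu.mult kap.mult r d := by
  induction r generalizing d with
  | zero => rfl
  | succ r ih => simp only [bwdDrag, bwdDragMult, ih]

theorem bwdDragMult_succ_ne_zero {l n m k : ℕ → ℕ} {r : ℕ} {d : CrossState}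
    (h : bwdDragMult t s a b l n m k (r + 1) d ≠ 0) :
    ∃ c, Preserved (l r) (k r) (n r) (m r) c d ∧ bwdDragMult t s a b l n m k r c ≠ 0 := by
  rw [bwdDragMult] at h
  obtain ⟨c, -, hne⟩ := Finset.exists_ne_zero_of_sum_ne_zero h
  split_ifs at hne with hc
  · exact ⟨c, hc, right_ne_zero_of_mul hne⟩
  · exact absurd rfl hne

/-- Arrow preservation in the first `r` columns, between the states `iiii` and `d`. -/
def Conserved (l n m k : ℕ → ℕ) (r : ℕ) (d : CrossState) : Prop :=
  (∑ i ∈ Finset.range r, l i + 1 = ∑ i ∈ Finset.range r, k i + d.rightBot ∧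
    ∑ i ∈ Finset.range r, k i + 1 = ∑ i ∈ Finset.range r, m i + d.rightTop) ∧
  ∑ i ∈ Finset.range r, l i + 1 = ∑ i ∈ Finset.range r, n i + d.leftBot ∧
    ∑ i ∈ Finset.range r, n i + 1 = ∑ i ∈ Finset.range r, m i + d.leftTop

/-- Preservation is added up over the columns; the initial state `iiii` contributes the four
summands `1`. Abstracting `f` covers both drags at once. -/
theorem arrow_conservation {l n m k : ℕ → ℕ} {f : ℕ → CrossState → ℝ}
    (h0 : ∀ d, f 0 d ≠ 0 → d = iiii)
    (hf : ∀ r d, f (r + 1) d ≠ 0 → ∃ c, Preserved (l r) (k r) (n r) (m r) c d ∧ f r c ≠ 0)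
    {r : ℕ} {d : CrossState} (h : f r d ≠ 0) : Conserved l n m k r d := by
  rw [Conserved]
  induction r generalizing d with
  | zero => simp [h0 d h, leftBot, leftTop, rightBot, rightTop]
  | succ r ih =>
    obtain ⟨c, ⟨⟨h1, h2⟩, h3, h4⟩, hc⟩ := hf r d h
    have := ih hc
    simp only [Finset.sum_range_succ]
    omega

theorem fwdDrag_conservation {r : ℕ} {d : CrossState}
    (h : fwdDrag t s a b lam kap mu nu r d ≠ 0) :
    Conserved lam.mult nu.mult mu.mult kap.mult r d :=
  arrow_conservation (f := fwdDrag t s a b lam kap mu nu)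
    (fun d hd => by by_contra hn; simp [fwdDrag, hn] at hd) (fun _ _ => fwdDrag_succ_ne_zero) h

theorem bwdDragMult_conservation {l n m k : ℕ → ℕ} {r : ℕ} {d : CrossState}
    (h : bwdDragMult t s a b l n m k r d ≠ 0) : Conserved l n m k r d :=
  arrow_conservation (f := bwdDragMult t s a b l n m k)
    (fun d hd => by by_contra hn; simp [bwdDragMult, hn] at hd)
    (fun _ _ => bwdDragMult_succ_ne_zero) h

theorem eq_oiio_of_preserved {l k m : ℕ} {c : CrossState} :
    Preserved l k 0 m c oiio ↔ c = oiio ∧ l = 0 ∧ k = 0 ∧ m = 0 := by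
  cases c <;> simp [Preserved, leftBot, leftTop, rightBot, rightTop]
  all_goals omega

/-- Once `nu` has no more parts the cross vertex stays in the state `oiio`. -/
theorem fwdDrag_eq_Ufwd {r : ℕ} (hr : nu.1 0 + 1 ≤ r) :
    fwdDrag t s a b lam kap mu nu r oiio = Ufwd t s a b kap nu lam mu := by
  induction r, hr using Nat.le_induction with
  | base => rfl
  | succ r hr ih =>
    have hn : ∀ j, nu.1 j < r := fun j => (nu.lt_first_add_one j).trans_le hr
    have hn0 := Sign.mult_eq_zero hn le_rfl
    rw [← ih, fwdDrag, hn0, Finset.sum_eq_single oiio]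
    · by_cases h : fwdDrag t s a b lam kap mu nu r oiio = 0
      · simp [h]
      -- All parts of `nu` lie left of column `r`, so conservation with final state `oiio` forces
      -- the same for `lam`, `kap` and `mu`. Column `r` is therefore empty in every layer and is
      -- passed with probability one.
      · obtain ⟨⟨h1, h2⟩, h3, -⟩ := fwdDrag_conservation h
        rw [(nu.sum_mult_eq_iff r).2 hn] at h3
        simp only [leftBot, rightBot, rightTop] at h1 h2 h3
        have hl := Sign.mult_eq_zero ((lam.sum_mult_eq_iff r).1 (by omega)) le_rfl
        have hk := Sign.mult_eq_zero ((kap.sum_mult_eq_iff r).1 (by omega)) le_rfl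
        have hm := Sign.mult_eq_zero ((mu.sum_mult_eq_iff r).1 (by omega)) le_rfl
        rw [if_pos (eq_oiio_of_preserved.2 ⟨rfl, hl, hk, hm⟩), hk]
        simp [fwdProb]
    · intro c _ hc
      rw [if_neg fun h => hc (eq_oiio_of_preserved.1 h).1]
    · simp

theorem bounds_of_bwdDrag_ne_zero {r : ℕ} (hr : nu.1 0 + 1 ≤ r)
    (h : bwdDrag t s a b lam nu mu kap r oiio ≠ 0) :
    (∀ j, lam.1 j < r) ∧ (∀ j, kap.1 j < r) ∧ ∀ j, mu.1 j < r := by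
  have hn : ∀ j, nu.1 j < r := fun j => (nu.lt_first_add_one j).trans_le hr
  rw [bwdDrag_eq] at h
  obtain ⟨⟨h1, h2⟩, h3, -⟩ := bwdDragMult_conservation h
  rw [(nu.sum_mult_eq_iff r).2 hn] at h3
  simp only [leftBot, rightBot, rightTop] at h1 h2 h3
  exact ⟨(lam.sum_mult_eq_iff r).1 (by omega), (kap.sum_mult_eq_iff r).1 (by omega),
    (mu.sum_mult_eq_iff r).1 (by omega)⟩

theorem bwdDrag_eq_Ubwd {r : ℕ} (hr : nu.1 0 + 1 ≤ r) :
    bwdDrag t s a b lam nu mu kap r oiio = Ubwd t s a b nu kap lam mu := by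
  induction r, hr using Nat.le_induction with
  | base => rfl
  | succ r hr ih =>
    have hn : ∀ j, nu.1 j < r := fun j => (nu.lt_first_add_one j).trans_le hr
    have hn0 := Sign.mult_eq_zero hn le_rfl
    rw [← ih, bwdDrag, hn0, Finset.sum_eq_single oiio]
    · by_cases h : bwdDrag t s a b lam nu mu kap r oiio = 0
      · simp [h]
      · obtain ⟨hl, hk, hm⟩ := bounds_of_bwdDrag_ne_zero hr h
        rw [if_pos (eq_oiio_of_preserved.2 ⟨rfl, Sign.mult_eq_zero hl le_rfl,
          Sign.mult_eq_zero hk le_rfl, Sign.mult_eq_zero hm le_rfl⟩)]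
        simp [bwdProb]
    · intro c _ hc
      rw [if_neg fun h => hc (eq_oiio_of_preserved.1 h).1]
    · simp

end Drag

/-! ### Signatures as finitely supported multiplicity functions. -/

/-- The parts below `r` form a final segment of the indices, because signatures are antitone. Each
part is thus determined by the cumulative multiplicities. -/
theorem Sign.lt_iff_le_add_sum_mult {N : ℕ} (l : Sign N) (j : Fin N) (r : ℕ) :
    l.1 j < r ↔ N ≤ j + ∑ i ∈ Finset.range r, l.mult i := by
  rw [Sign.sum_mult]
  constructor
  · intro h
    have hsub : Finset.Ici j ⊆ Finset.univ.filter fun i => l.1 i < r := fun i hi =>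
      Finset.mem_filter.2 ⟨Finset.mem_univ _, (l.2 (Finset.mem_Ici.1 hi)).trans_lt h⟩
    have := Finset.card_le_card hsub
    rw [Fin.card_Ici] at this
    omega
  · intro h
    by_contra hn
    have hsub : (Finset.univ.filter fun i => l.1 i < r) ⊆ Finset.Ioi j := fun i hi => by
      rw [Finset.mem_Ioi]
      by_contra hij
      have h1 := l.2 (not_lt.1 hij)
      have h2 := (Finset.mem_filter.1 hi).2
      omega
    have := Finset.card_le_card hsub
    rw [Fin.card_Ioi] at this
    omega

theorem Sign.mult_injective {N : ℕ} : Function.Injective (Sign.mult : Sign N → ℕ → ℕ) := by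
  intro l l' h
  refine Subtype.ext (funext fun j => ?_)
  refine eq_of_forall_lt_iff fun r => ?_
  have h1 := l.lt_iff_le_add_sum_mult j (r + 1)
  have h2 := l'.lt_iff_le_add_sum_mult j (r + 1)
  rw [h, ← h2] at h1
  omega

theorem card_fin_filter_le_add {N S : ℕ} (h : S ≤ N) :
    (Finset.univ.filter fun j : Fin N => N ≤ j + S).card = S := by
  rw [Finset.card_filter, Fin.sum_univ_eq_sum_range (fun j => if N ≤ j + S then 1 else 0),
    ← Finset.card_filter]
  have : (Finset.range N).filter (fun j => N ≤ j + S) = Finset.Ico (N - S) N := by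
    ext j
    simp only [Finset.mem_filter, Finset.mem_range, Finset.mem_Ico]
    omega
  rw [this, Nat.card_Ico]
  omega

theorem Sign.exists_mult_eq {N R : ℕ} {f : ℕ → ℕ} (hf : ∀ r, R ≤ r → f r = 0)
    (hN : ∑ r ∈ Finset.range R, f r = N) : ∃ l : Sign N, l.mult = f := by
  have hmono : Monotone fun r => ∑ i ∈ Finset.range r, f i := fun a b hab =>
    Finset.sum_le_sum_of_subset (Finset.range_subset_range.2 hab)
  have hle : ∀ r, ∑ i ∈ Finset.range r, f i ≤ N := fun r => by
    rcases le_total r R with h | h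
    · exact (hmono h).trans_eq hN
    · rw [← hN, ← Finset.sum_subset (Finset.range_subset_range.2 h)]
      intro i _ hi
      exact hf i (by simpa using hi)
  have hex : ∀ j : Fin N, ∃ r, N ≤ j + ∑ i ∈ Finset.range (r + 1), f i := fun j =>
    ⟨R, by have := hmono R.le_succ; simp only [Nat.succ_eq_add_one] at this; omega⟩
  classical
  have hlt : ∀ (j : Fin N) r, Nat.find (hex j) < r ↔ N ≤ j + ∑ i ∈ Finset.range r, f i := by
    intro j r
    rcases r with _ | r
    · simp
    · rw [Nat.lt_succ_iff]
      constructor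
      · intro h
        have h1 := hmono (Nat.succ_le_succ h)
        have h2 := Nat.find_spec (hex j)
        simp only [Nat.succ_eq_add_one] at h1
        omega
      · exact fun h => Nat.find_min' (hex j) h
  -- Part `j` is the first site at which the cumulative count reaches `N - j`, as
  -- `Sign.lt_iff_le_add_sum_mult` dictates.
  let l : Sign N := ⟨fun j => Nat.find (hex j), fun i j hij => by
    refine Nat.find_min' (hex j) ((Nat.find_spec (hex i)).trans ?_)
    exact Nat.add_le_add_right hij _⟩
  have hsum : ∀ r, ∑ i ∈ Finset.range r, l.mult i = ∑ i ∈ Finset.range r, f i := fun r => by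
    rw [Sign.sum_mult]
    simp only [l, hlt]
    exact card_fin_filter_le_add (hle r)
  refine ⟨l, funext fun r => ?_⟩
  have h1 := hsum r
  have h2 := hsum (r + 1)
  rw [Finset.sum_range_succ, Finset.sum_range_succ] at h2
  omega

/-- The signatures with all parts smaller than `R`. -/
def Sign.below (N R : ℕ) : Finset (Sign N) :=
  Set.Finite.toFinset (s := {l : Sign N | ∀ j, l.1 j < R})
    (Set.Finite.of_finite_image ((Set.Finite.pi' fun _ => Set.finite_lt_nat R).subset (by
      rintro _ ⟨l, hl, rfl⟩
      exact hl)) Subtype.val_injective.injOn)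

theorem Sign.mem_below {N R : ℕ} {l : Sign N} : l ∈ Sign.below N R ↔ ∀ j, l.1 j < R := by
  simp [Sign.below]

open Classical in
/-- The functions on `ℕ` with values smaller than `M` that vanish from `r` on. -/
def boundedFunctions (M : ℕ) : ℕ → Finset (ℕ → ℕ)
  | 0 => {0}
  | r + 1 => (boundedFunctions M r ×ˢ Finset.range M).image fun p => Function.update p.1 r p.2

theorem mem_boundedFunctions {M r : ℕ} {f : ℕ → ℕ} :
    f ∈ boundedFunctions M r ↔ (∀ i < r, f i < M) ∧ ∀ i, r ≤ i → f i = 0 := by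
  induction r generalizing f with
  | zero => simp [boundedFunctions, funext_iff]
  | succ r ih =>
    simp only [boundedFunctions, Finset.mem_image, Finset.mem_product, Finset.mem_range, ih,
      Prod.exists]
    constructor
    · rintro ⟨g, k, ⟨⟨h1, h2⟩, hk⟩, rfl⟩
      constructor
      · intro i hi
        rcases Nat.lt_succ_iff_lt_or_eq.1 hi with h | rfl
        · rw [Function.update_of_ne h.ne]
          exact h1 i h
        · rwa [Function.update_self]
      · intro i hi
        rw [Function.update_of_ne (by omega)]
        exact h2 i (by omega)
    · rintro ⟨h1, h2⟩
      refine ⟨Function.update f r 0, f r, ⟨⟨fun i hi => ?_, fun i hi => ?_⟩, h1 r r.lt_succ_self⟩, ?_⟩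
      · rw [Function.update_of_ne hi.ne]
        exact h1 i (by omega)
      · rcases hi.eq_or_lt with rfl | h
        · rw [Function.update_self]
        · rw [Function.update_of_ne h.ne']
          exact h2 i h
      · simp

theorem sum_boundedFunctions_succ {M r : ℕ} (φ : (ℕ → ℕ) → ℝ) :
    ∑ f ∈ boundedFunctions M (r + 1), φ f =
      ∑ f ∈ boundedFunctions M r, ∑ k ∈ Finset.range M, φ (Function.update f r k) := by
  classical
  rw [boundedFunctions, Finset.sum_image, Finset.sum_product]
  rintro ⟨f, k⟩ hf ⟨f', k'⟩ hf' h
  simp only [Finset.coe_product, Set.mem_prod, Finset.mem_coe, mem_boundedFunctions] at hf hf' h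
  have hk : k = k' := by simpa using congrFun h r
  refine Prod.ext (funext fun i => ?_) hk
  change f i = f' i
  by_cases hi : i = r
  · rw [hi, hf.1.2 r le_rfl, hf'.1.2 r le_rfl]
  · simpa [Function.update_of_ne hi] using congrFun h i

/-! ### Total mass of the backward drag. -/

section Sum

variable {t s a b : ℝ}

theorem bwdDragMult_congr {l n m k k' : ℕ → ℕ} {r : ℕ} (h : ∀ i < r, k i = k' i)
    (d : CrossState) : bwdDragMult t s a b l n m k r d = bwdDragMult t s a b l n m k' r d := by
  induction r generalizing d with
  | zero => rfl
  | succ r ih =>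
    simp only [bwdDragMult, ih fun i hi => h i (hi.trans r.lt_succ_self), h r r.lt_succ_self]

/-- Unlike signatures, multiplicity functions can be summed one column at a time: the last column
contributes one by `bwdProb_column_sum`, the others by induction. Nonzero row weights supply the
arrows on the edges between columns and keep the denominators away from zero. -/
theorem sum_bwdDragMult (ht0 : 0 ≤ t) (ht1 : t < 1) (hs0 : -1 < s) (hs1 : s ≤ 0)
    (hb : 0 ≤ b) (hab : b < a) {z z' : ℝ} {l n m : ℕ → ℕ} {M : ℕ} (hM : ∀ i, l i + 1 < M)
    {r : ℕ} {d : CrossState} (h1 : rowWeight t s b z' l n r d.leftBot ≠ 0)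
    (h2 : rowWeight t s a z n m r d.leftTop ≠ 0) :
    ∑ k ∈ boundedFunctions M r, bwdDragMult t s a b l n m k r d = 1 := by
  induction r generalizing d with
  | zero =>
    rw [boundedFunctions, Finset.sum_singleton, bwdDragMult]
    cases d <;> simp [rowWeight, leftBot, leftTop] at h1 h2 ⊢
  | succ r ih =>
    obtain ⟨jB, hjB, eB, hB, hw⟩ := exists_of_rowWeight_ne_zero h1
    obtain ⟨jT, hjT, eT, hT, -⟩ := exists_of_rowWeight_ne_zero h2
    rw [sum_boundedFunctions_succ, Finset.sum_comm,
      ← bwdProb_column_sum ht0 ht1 hs0 hs1 hb hab (hM r) eB eT hjB hjT hw]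
    refine Finset.sum_congr rfl fun k _ => ?_
    have hstep : ∀ f : ℕ → ℕ, bwdDragMult t s a b l n m (Function.update f r k) (r + 1) d =
        ∑ c : CrossState, if Preserved (l r) k (n r) (m r) c d then
          bwdProb t s a b (n r) d c * bwdDragMult t s a b l n m f r c else 0 := fun f => by
      simp only [bwdDragMult, Function.update_self]
      refine Finset.sum_congr rfl fun c _ => ?_
      rw [bwdDragMult_congr fun i hi => Function.update_of_ne hi.ne k f]
    simp_rw [hstep]
    rw [Finset.sum_comm]
    refine Finset.sum_congr rfl fun c _ => ?_
    split_ifs with hc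
    · obtain ⟨-, h3, h4⟩ := hc
      have e1 : c.leftBot = jB := by omega
      have e2 : c.leftTop = jT := by omega
      rw [← Finset.mul_sum, ih (by rwa [e1]) (by rwa [e2]), mul_one]
    · exact Finset.sum_const_zero

end Sum

/-! ### Normalized row weights and reversibility for rows. -/

/-- The weight of the row between `al` and `be` with no arrow leaving at the right. -/
def upWeight (t s x : ℝ) {N N' : ℕ} (al : Sign N) (be : Sign N') : ℝ :=
  rowWeight t s x (1 - s * x)⁻¹ al.mult be.mult (∑ j, al.1 j + ∑ j, be.1 j + 1) 0

/-- The weight of the row between `al` and `be` with an arrow leaving at the right. -/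
def rightWeight (t s x : ℝ) {N N' : ℕ} (al : Sign N) (be : Sign N') : ℝ :=
  rowWeight t s x (x - s)⁻¹ al.mult be.mult (∑ j, al.1 j + ∑ j, be.1 j + 1) 1

section Weights

variable {t s x a b : ℝ} {N N' : ℕ}

/-- The cutoff in `upWeight` and `rightWeight` is just one that exceeds all parts: the normalization
`z` gives empty columns weight one, so any other such cutoff yields the same value. -/
theorem rowWeight_eq_of_le {z : ℝ} {j : ℕ} (hj : j ≤ 1) (hz : z * vertexWeight t s x 0 j 0 j = 1)
    {al : Sign N} {be : Sign N'} {r : ℕ} (hal : ∀ i, al.1 i < r) (hbe : ∀ i, be.1 i < r) :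
    rowWeight t s x z al.mult be.mult r j =
      rowWeight t s x z al.mult be.mult (∑ j, al.1 j + ∑ j, be.1 j + 1) j := by
  have h1 : ∀ i, al.1 i < ∑ j, al.1 j + ∑ j, be.1 j + 1 := fun i => by
    have := Finset.single_le_sum (fun j _ => Nat.zero_le (al.1 j)) (Finset.mem_univ i)
    omega
  have h2 : ∀ i, be.1 i < ∑ j, al.1 j + ∑ j, be.1 j + 1 := fun i => by
    have := Finset.single_le_sum (fun j _ => Nat.zero_le (be.1 j)) (Finset.mem_univ i)
    omega
  rcases le_total r (∑ j, al.1 j + ∑ j, be.1 j + 1) with h | h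
  · exact (rowWeight_stable hj hz (fun i => Sign.mult_eq_zero hal)
      (fun i => Sign.mult_eq_zero hbe) h).symm
  · exact rowWeight_stable hj hz (fun i => Sign.mult_eq_zero h1)
      (fun i => Sign.mult_eq_zero h2) h

theorem rowWeight_eq_upWeight (hx : 0 ≤ x) (hs1 : s ≤ 0) {al : Sign N} {be : Sign N'} {r : ℕ}
    (hal : ∀ i, al.1 i < r) (hbe : ∀ i, be.1 i < r) :
    rowWeight t s x (1 - s * x)⁻¹ al.mult be.mult r 0 = upWeight t s x al be := by
  refine rowWeight_eq_of_le zero_le_one ?_ hal hbe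
  have : 1 - s * x ≠ 0 := by nlinarith
  simp [vertexWeight, this]

theorem rowWeight_eq_rightWeight (hx : 0 < x) (hs1 : s ≤ 0) {al : Sign N} {be : Sign N'} {r : ℕ}
    (hal : ∀ i, al.1 i < r) (hbe : ∀ i, be.1 i < r) :
    rowWeight t s x (x - s)⁻¹ al.mult be.mult r 1 = rightWeight t s x al be := by
  refine rowWeight_eq_of_le le_rfl ?_ hal hbe
  have : x - s ≠ 0 := by linarith
  simp [vertexWeight, this]

variable {lam kap : Sign N} {mu nu : Sign (N + 1)}

theorem Sign.exists_bound (l : Sign N) : ∃ R, ∀ j, l.1 j < R :=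
  ⟨∑ j, l.1 j + 1, fun j => Nat.lt_succ_of_le
    (Finset.single_le_sum (fun j _ => Nat.zero_le (l.1 j)) (Finset.mem_univ j))⟩

/-- Reversibility of the two random moves of the cross vertex through the whole row. -/
theorem weight_mul_Ufwd (ht0 : 0 ≤ t) (ht1 : t < 1) (hs0 : -1 < s) (hs1 : s ≤ 0)
    (hb : 0 ≤ b) (hab : b < a) (lam kap : Sign N) (mu nu : Sign (N + 1)) :
    upWeight t s b kap mu * rightWeight t s a lam kap * Ufwd t s a b kap nu lam mu =
      (a - b) / (a - t * b) * (upWeight t s b lam nu * rightWeight t s a nu mu) *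
        Ubwd t s a b nu kap lam mu := by
  obtain ⟨R1, h1⟩ := lam.exists_bound
  obtain ⟨R2, h2⟩ := kap.exists_bound
  obtain ⟨R3, h3⟩ := mu.exists_bound
  obtain ⟨R, hR⟩ : ∃ R, R = R1 + R2 + R3 + (nu.1 0 + 1) := ⟨_, rfl⟩
  have g1 : ∀ j, lam.1 j < R := fun j => by have := h1 j; omega
  have g2 : ∀ j, kap.1 j < R := fun j => by have := h2 j; omega
  have g3 : ∀ j, mu.1 j < R := fun j => by have := h3 j; omega
  have g4 : ∀ j, nu.1 j < R := fun j => by have := nu.lt_first_add_one j; omega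
  have ha : 0 < a := hb.trans_lt hab
  have := drag_reversibility (lam := lam) (kap := kap) (mu := mu) (nu := nu) ht0 ht1 hs0 hs1 hb hab
    (a - s)⁻¹ (1 - s * b)⁻¹ R oiio
  rw [fwdDrag_eq_Ufwd (by omega), bwdDrag_eq_Ubwd (by omega)] at this
  simp only [leftBot, leftTop, rightBot, rightTop, crossWeight] at this
  rw [rowWeight_eq_upWeight hb hs1 g2 g3, rowWeight_eq_upWeight hb hs1 g1 g4,
    rowWeight_eq_rightWeight ha hs1 g1 g2, rowWeight_eq_rightWeight ha hs1 g4 g3] at this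
  linear_combination this

theorem mem_below_of_Ubwd_ne_zero (h : Ubwd t s a b nu kap lam mu ≠ 0) :
    kap ∈ Sign.below N (nu.1 0 + 1) :=
  Sign.mem_below.2 (bounds_of_bwdDrag_ne_zero le_rfl h).2.1

/-- The backward transition probabilities add up to one unless `nu` has weight zero. -/
theorem sum_Ubwd (ht0 : 0 ≤ t) (ht1 : t < 1) (hs0 : -1 < s) (hs1 : s ≤ 0)
    (hb : 0 ≤ b) (hab : b < a)
    (h : upWeight t s b lam nu * rightWeight t s a nu mu ≠ 0) :
    ∑ kap ∈ Sign.below N (nu.1 0 + 1), Ubwd t s a b nu kap lam mu = 1 := by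
  obtain ⟨R1, h1⟩ := lam.exists_bound
  obtain ⟨R3, h3⟩ := mu.exists_bound
  obtain ⟨R, hR⟩ : ∃ R, R = R1 + R3 + (nu.1 0 + 1) := ⟨_, rfl⟩
  have g1 : ∀ j, lam.1 j < R := fun j => by have := h1 j; omega
  have g3 : ∀ j, mu.1 j < R := fun j => by have := h3 j; omega
  have g4 : ∀ j, nu.1 j < R := fun j => by have := nu.lt_first_add_one j; omega
  have ha : 0 < a := hb.trans_lt hab
  rw [← rowWeight_eq_upWeight hb hs1 g1 g4, ← rowWeight_eq_rightWeight ha hs1 g4 g3] at h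
  -- Multiplicities are at most `N`, so `N + 2` satisfies the bound `lam.mult i + 1 < M`.
  rw [← sum_bwdDragMult (M := N + 2) (d := oiio) ht0 ht1 hs0 hs1 hb hab
    (fun i => by have := lam.mult_le i; omega) (left_ne_zero_of_mul h) (right_ne_zero_of_mul h)]
  refine Finset.sum_of_injOn Sign.mult Sign.mult_injective.injOn ?_ ?_ ?_
  · intro kap hk
    rw [Finset.mem_coe, Sign.mem_below] at hk
    rw [Finset.mem_coe, mem_boundedFunctions]
    refine ⟨fun i _ => by have := kap.mult_le i; omega, fun i hi => ?_⟩
    exact Sign.mult_eq_zero hk (by omega)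
  -- A function contributing to the sum has total mass `N` by conservation, hence comes from a
  -- signature.
  · intro f hf hf'
    by_contra hne
    obtain ⟨⟨e1, -⟩, e3, -⟩ := bwdDragMult_conservation hne
    rw [(lam.sum_mult_eq_iff R).2 g1] at e1
    simp only [rightBot] at e1
    obtain ⟨kap, rfl⟩ := Sign.exists_mult_eq (N := N) (mem_boundedFunctions.1 hf).2 (by omega)
    refine hf' ⟨kap, ?_, rfl⟩
    rw [← bwdDrag_eq, bwdDrag_eq_Ubwd (by omega)] at hne
    exact mem_below_of_Ubwd_ne_zero hne
  · intro kap _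
    rw [← bwdDrag_eq, bwdDrag_eq_Ubwd (by omega)]

theorem Sign.zero_mult_zero (N : ℕ) : (Sign.zero N).mult 0 = N := by
  simp [Sign.mult, Sign.zero]

/-- From column `1` on the top row is empty and no arrow leaves at the right, so going from right to
left every positive site of `al` must be empty. This makes the left boundary condition propagate in
`staircase_law`. -/
theorem eq_zero_of_upWeight_zero_ne_zero (hx : 0 ≤ x) (hs1 : s ≤ 0) {al : Sign N}
    (h : upWeight t s x al (Sign.zero (N + 1)) ≠ 0) : al = Sign.zero N := by
  obtain ⟨R, hR⟩ := al.exists_bound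
  have hR' : ∀ j, al.1 j < R + 1 := fun j => (hR j).trans R.lt_succ_self
  rw [← rowWeight_eq_upWeight hx hs1 hR' fun _ => R.succ_pos] at h
  have key : ∀ r, rowWeight t s x (1 - s * x)⁻¹ al.mult (Sign.zero (N + 1)).mult (r + 1) 0 ≠ 0 →
      ∀ i, 1 ≤ i → i ≤ r → al.mult i = 0 := by
    intro r
    induction r with
    | zero => intro _ i h1 h2; omega
    | succ r ih =>
      intro h i h1 h2
      obtain ⟨j, hj, e, hne, -⟩ := exists_of_rowWeight_ne_zero h
      rw [Sign.mult_eq_zero (l := Sign.zero (N + 1)) (R := 1) (fun _ => one_pos) (by omega)] at e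
      obtain rfl : j = 0 := by omega
      rcases h2.eq_or_lt with rfl | h2
      · omega
      · exact ih hne i h1 (by omega)
  refine Subtype.ext (funext fun j => ?_)
  show al.1 j = 0
  by_contra hj
  have := key R h (al.1 j) (by omega) (hR j).le
  rw [Sign.mult, Finset.card_eq_zero, Finset.filter_eq_empty_iff] at this
  exact this (Finset.mem_univ j) rfl

theorem upWeight_zero_zero_ne_zero (ht0 : 0 ≤ t) (ht1 : t < 1) (hx : 0 ≤ x) (hs1 : s ≤ 0) :
    upWeight t s x (Sign.zero N) (Sign.zero (N + 1)) ≠ 0 := by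
  rw [← rowWeight_eq_upWeight (r := 1) hx hs1 (fun _ => one_pos) fun _ => one_pos,
    rowWeight_succ (j := 1) le_rfl (by rw [Sign.zero_mult_zero, Sign.zero_mult_zero])]
  have h1 : 1 - s * x ≠ 0 := by nlinarith
  have h2 : 1 - t ^ (N + 1) ≠ 0 := by
    have := pow_lt_one₀ ht0 ht1 N.add_one_ne_zero; linarith
  simp [rowWeight, vertexWeight, Sign.zero_mult_zero, h1, h2]

theorem rightWeight_empty (hx : 0 < x) (hs1 : s ≤ 0) (al be : Sign 0) :
    rightWeight t s x al be = 1 := by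
  rw [← rowWeight_eq_rightWeight (r := 0) hx hs1 (fun i => i.elim0) fun i => i.elim0]
  rfl

end Weights

/-! ### Events prescribing the field on sets of lattice points. -/

theorem hasSum_measureReal_inter_preimage {Ω T : Type*} [MeasurableSpace Ω] [Countable T]
    [MeasurableSpace T] [MeasurableSingletonClass T] (P : Measure Ω) [IsFiniteMeasure P]
    {X : Ω → T} (hX : Measurable X) (A : Set Ω) :
    HasSum (fun τ => P.real (A ∩ X ⁻¹' {τ})) (P.real A) := by
  have hm : ∀ τ, MeasurableSet (X ⁻¹' {τ}) := fun τ => hX (measurableSet_singleton τ)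
  have hU : ⋃ τ, X ⁻¹' {τ} = Set.univ := by ext ω; simp
  have hsum : ∑' τ, P (A ∩ X ⁻¹' {τ}) = P A := by
    -- Only the fibres of `X` need to be measurable: additivity is applied to the restriction of `P`
    -- to `A`.
    have h := measure_iUnion (μ := P.restrict A)
      (fun i j hij => Set.disjoint_left.2 fun ω hi hj => hij (by
        rw [Set.mem_preimage, Set.mem_singleton_iff] at hi hj; rw [← hi, ← hj])) hm
    rw [hU, Measure.restrict_apply_univ] at h
    rw [h]
    exact tsum_congr fun τ => by rw [Measure.restrict_apply (hm τ), Set.inter_comm]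
  have := ENNReal.hasSum_toReal (f := fun τ => P (A ∩ X ⁻¹' {τ})) (by rw [hsum]; finiteness)
  rwa [← ENNReal.tsum_toReal_eq (fun _ => by finiteness), hsum] at this

/-- An array of signatures. -/
abbrev SignArray : Type := (x y : ℕ) → Sign y

/-- Replace the signatures at the points of `I` by those of `τ`. -/
def patch (I : Finset (ℕ × ℕ)) (τ : (p : I) → Sign p.1.2) (a : SignArray) : SignArray :=
  fun x y => if h : (x, y) ∈ I then τ ⟨(x, y), h⟩ else a x y

theorem patch_of_mem {I : Finset (ℕ × ℕ)} {τ : (p : I) → Sign p.1.2} {a : SignArray} {x y : ℕ}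
    (h : (x, y) ∈ I) : patch I τ a x y = τ ⟨(x, y), h⟩ := dif_pos h

theorem patch_of_notMem {I : Finset (ℕ × ℕ)} {τ : (p : I) → Sign p.1.2} {a : SignArray} {x y : ℕ}
    (h : (x, y) ∉ I) : patch I τ a x y = a x y := dif_neg h

/-- Replace the signature at one point. -/
def setAt (a : SignArray) (x y : ℕ) (l : Sign y) : SignArray :=
  fun x' y' => if h : x' = x ∧ y' = y then h.2 ▸ l else a x' y'

theorem setAt_self (a : SignArray) (x y : ℕ) (l : Sign y) : setAt a x y l x y = l := by
  simp [setAt]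

theorem setAt_of_ne (a : SignArray) {x y x' y' : ℕ} (l : Sign y) (h : ¬(x' = x ∧ y' = y)) :
    setAt a x y l x' y' = a x' y' := dif_neg h

section Field

variable {Ω : Type*}

/-- The event that the array agrees with `a` on `J`. -/
def agree (Λ : (x y : ℕ) → Ω → Sign y) (a : SignArray) (J : Set (ℕ × ℕ)) : Set Ω :=
  {ω | ∀ x y, (x, y) ∈ J → Λ x y ω = a x y}

theorem agree_inter_preimage {Λ : (x y : ℕ) → Ω → Sign y} {a : SignArray} {J : Set (ℕ × ℕ)}
    {I : Finset (ℕ × ℕ)} (hIJ : ∀ p ∈ I, p ∉ J) (τ : (p : I) → Sign p.1.2) :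
    agree Λ a J ∩ (fun ω (p : I) => Λ p.1.1 p.1.2 ω) ⁻¹' {τ} =
      agree Λ (patch I τ a) (J ∪ I) := by
  ext ω
  simp only [agree, Set.mem_inter_iff, Set.mem_ofPred_eq, Set.mem_preimage,
    Set.mem_singleton_iff, Set.mem_union, Finset.mem_coe]
  constructor
  · rintro ⟨h1, h2⟩ x y hxy
    by_cases h : (x, y) ∈ I
    · rw [patch_of_mem h, ← h2]
    · rw [patch_of_notMem h]
      exact h1 x y (hxy.resolve_right h)
  · intro h
    refine ⟨fun x y hxy => ?_, funext fun p => ?_⟩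
    · rw [h x y (Or.inl hxy), patch_of_notMem fun hI => hIJ _ hI hxy]
    · rw [h p.1.1 p.1.2 (Or.inr p.2), patch_of_mem p.2]

variable [MeasurableSpace Ω] {P : Measure Ω} [IsProbabilityMeasure P]
  {Λ : (x y : ℕ) → Ω → Sign y} {t s : ℝ} {u v : ℕ → ℝ}

theorem hasSum_agree_patch (hΛ : ∀ x y, Measurable (Λ x y)) {a : SignArray} {J : Set (ℕ × ℕ)}
    {I : Finset (ℕ × ℕ)} (hIJ : ∀ p ∈ I, p ∉ J) (B : Set Ω) :
    HasSum (fun τ => P.real (agree Λ (patch I τ a) (J ∪ I) ∩ B)) (P.real (agree Λ a J ∩ B)) := by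
  have hX : Measurable fun ω (p : I) => Λ p.1.1 p.1.2 ω :=
    measurable_pi_lambda _ fun p => hΛ p.1.1 p.1.2
  have := hasSum_measureReal_inter_preimage P hX (agree Λ a J ∩ B)
  simpa only [Set.inter_right_comm _ B, agree_inter_preimage hIJ] using this

theorem measurableSet_agree (hΛ : ∀ x y, Measurable (Λ x y)) (a : SignArray) (J : Set (ℕ × ℕ)) :
    MeasurableSet (agree Λ a J) := by
  simp only [agree, Set.ofPred_forall]
  exact MeasurableSet.iInter fun x => MeasurableSet.iInter fun y => MeasurableSet.iInter fun _ =>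
    hΛ x y (measurableSet_singleton _)

/-! ### The law of the field on a staircase. -/

/-- The forward transition probability at a square, with corner values from `a`. -/
def squareFwd (t s : ℝ) (u v : ℕ → ℝ) (a : SignArray) (p : ℕ × ℕ) : ℝ :=
  Ufwd t s (v (p.1 + 1)) (u (p.2 + 1)) (a p.1 p.2) (a (p.1 + 1) (p.2 + 1)) (a (p.1 + 1) p.2)
    (a p.1 (p.2 + 1))

/-- The backward transition probability at a square, with corner values from `a`. -/
def squareBwd (t s : ℝ) (u v : ℕ → ℝ) (a : SignArray) (p : ℕ × ℕ) : ℝ :=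
  Ubwd t s (v (p.1 + 1)) (u (p.2 + 1)) (a (p.1 + 1) (p.2 + 1)) (a p.1 p.2) (a (p.1 + 1) p.2)
    (a p.1 (p.2 + 1))

/-- The weight of the lower left corner of a square. -/
def lowerWeight (t s : ℝ) (u v : ℕ → ℝ) (a : SignArray) (p : ℕ × ℕ) : ℝ :=
  upWeight t s (u (p.2 + 1)) (a p.1 p.2) (a p.1 (p.2 + 1)) *
    rightWeight t s (v (p.1 + 1)) (a (p.1 + 1) p.2) (a p.1 p.2)

/-- The weight of the upper right corner of a square. -/
def upperWeight (t s : ℝ) (u v : ℕ → ℝ) (a : SignArray) (p : ℕ × ℕ) : ℝ :=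
  upWeight t s (u (p.2 + 1)) (a (p.1 + 1) p.2) (a (p.1 + 1) (p.2 + 1)) *
    rightWeight t s (v (p.1 + 1)) (a (p.1 + 1) (p.2 + 1)) (a p.1 (p.2 + 1))

/-- The weight of the cross vertex in its final state. -/
def squareRatio (t : ℝ) (u v : ℕ → ℝ) (p : ℕ × ℕ) : ℝ :=
  (v (p.1 + 1) - u (p.2 + 1)) / (v (p.1 + 1) - t * u (p.2 + 1))

/-- The event that the field takes the values of `a` at the upper right corners of the squares
in `S`. -/
def agreeAbove (Λ : (x y : ℕ) → Ω → Sign y) (a : SignArray) (S : Finset (ℕ × ℕ)) : Set Ω :=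
  {ω | ∀ p ∈ S, Λ (p.1 + 1) (p.2 + 1) ω = a (p.1 + 1) (p.2 + 1)}

/-- The points of two consecutive antidiagonals. -/
def staircase (m : ℕ) : Set (ℕ × ℕ) := {p | p.1 + p.2 = m ∨ p.1 + p.2 = m + 1}

/-- The defining property conditions on the whole past. Its transition probabilities depend on the
staircase alone, so the values below it can be summed out. -/
theorem staircase_markov (hΛ : IsYangBaxterField t s u v P Λ) (a : SignArray) (m : ℕ)
    {S : Finset (ℕ × ℕ)} (hS : S ⊆ Finset.HasAntidiagonal.antidiagonal m) :
    P.real (agree Λ a (staircase m) ∩ agreeAbove Λ a S) =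
      P.real (agree Λ a (staircase m)) * ∏ p ∈ S, squareFwd t s u v a p := by
  have hstep : ∀ a : SignArray, P.real (agree Λ a {p | p.1 + p.2 ≤ m + 1} ∩ agreeAbove Λ a S) =
      P.real (agree Λ a {p | p.1 + p.2 ≤ m + 1}) * ∏ p ∈ S, squareFwd t s u v a p := by
    intro a
    by_cases h0 : P (agree Λ a {p | p.1 + p.2 ≤ m + 1}) = 0
    · rw [measureReal_def, measureReal_def, h0, measure_mono_null Set.inter_subset_left h0]
      simp
    · have := hΛ.step m a h0 S hS
      have hm := measurableSet_agree hΛ.measurable a {p | p.1 + p.2 ≤ m + 1}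
      change (P[|agree Λ a {p | p.1 + p.2 ≤ m + 1}]).real (agreeAbove Λ a S) =
        ∏ p ∈ S, squareFwd t s u v a p at this
      rw [← this, measureReal_def, measureReal_def, measureReal_def, cond_apply hm,
        ENNReal.toReal_mul, ENNReal.toReal_inv, ← mul_assoc, mul_inv_cancel₀, one_mul]
      exact ENNReal.toReal_ne_zero.2 ⟨h0, by finiteness⟩
  let I : Finset (ℕ × ℕ) := (Finset.range m ×ˢ Finset.range m).filter fun p => p.1 + p.2 < m
  have hI : ∀ p, p ∈ I ↔ p.1 + p.2 < m := fun p => by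
    simp only [I, Finset.mem_filter, Finset.mem_product, Finset.mem_range]
    omega
  have hIJ : ∀ p ∈ I, p ∉ staircase m := fun p hp hp' => by
    rw [hI] at hp
    rcases hp' with h | h <;> omega
  have hU : staircase m ∪ I = {p | p.1 + p.2 ≤ m + 1} := by
    ext p
    simp only [staircase, Set.mem_union, Set.mem_ofPred_eq, Finset.mem_coe, hI]
    omega
  have h1 := hasSum_agree_patch (P := P) hΛ.measurable (a := a) hIJ (agreeAbove Λ a S)
  have h2 := (hasSum_agree_patch (P := P) hΛ.measurable (a := a) hIJ Set.univ).mul_right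
    (∏ p ∈ S, squareFwd t s u v a p)
  simp only [Set.inter_univ, hU] at h1 h2
  refine h1.unique (Eq.subst (motive := fun F => HasSum F _) (funext fun τ => ?_) h2)
  symm
  have hp : ∀ x y, m ≤ x + y → patch I τ a x y = a x y := fun x y hxy =>
    patch_of_notMem (by rw [hI]; exact not_lt.2 hxy)
  have hS' : ∀ p ∈ S, p.1 + p.2 = m := fun p hp => Finset.HasAntidiagonal.mem_antidiagonal.1 (hS hp)
  have e1 : agreeAbove Λ a S = agreeAbove Λ (patch I τ a) S := by
    ext ω
    refine forall₂_congr fun p hpS => ?_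
    rw [hp _ _ (by have := hS' p hpS; omega)]
  have e2 : ∏ p ∈ S, squareFwd t s u v a p = ∏ p ∈ S, squareFwd t s u v (patch I τ a) p := by
    refine Finset.prod_congr rfl fun p hpS => ?_
    have := hS' p hpS
    simp only [squareFwd]
    rw [hp _ _ (by omega), hp _ _ (by omega), hp _ _ (by omega), hp _ _ (by omega)]
  rw [e1, e2, hstep]

theorem lowerWeight_mul_squareFwd (ht0 : 0 ≤ t) (ht1 : t < 1) (hs0 : -1 < s) (hs1 : s ≤ 0)
    (huv : ∀ i j : ℕ, 1 ≤ i → 1 ≤ j → 0 ≤ u i ∧ u i < v j ∧ v j < 1) (a : SignArray) (p : ℕ × ℕ) :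
    lowerWeight t s u v a p * squareFwd t s u v a p =
      squareRatio t u v p * upperWeight t s u v a p * squareBwd t s u v a p := by
  obtain ⟨h1, h2, -⟩ := huv (p.2 + 1) (p.1 + 1) (by omega) (by omega)
  exact weight_mul_Ufwd ht0 ht1 hs0 hs1 h1 h2 _ _ _ _

theorem hasSum_upperWeight_mul_squareBwd (ht0 : 0 ≤ t) (ht1 : t < 1) (hs0 : -1 < s) (hs1 : s ≤ 0)
    (huv : ∀ i j : ℕ, 1 ≤ i → 1 ≤ j → 0 ≤ u i ∧ u i < v j ∧ v j < 1) (m : ℕ) (a : SignArray) :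
    HasSum (fun τ => ∏ p ∈ Finset.HasAntidiagonal.antidiagonal m,
        (upperWeight t s u v a p *
          squareBwd t s u v (patch (Finset.HasAntidiagonal.antidiagonal m) τ a) p))
      (∏ p ∈ Finset.HasAntidiagonal.antidiagonal m, upperWeight t s u v a p) := by
  set D := Finset.HasAntidiagonal.antidiagonal m with hD
  -- If some upper weight vanishes, the backward probabilities at that square need not sum to one,
  -- but both sides are then zero.
  by_cases h0 : ∃ p ∈ D, upperWeight t s u v a p = 0
  · obtain ⟨p, hp, hp0⟩ := h0
    rw [Finset.prod_eq_zero hp hp0]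
    convert hasSum_zero with τ
    exact Finset.prod_eq_zero hp (by rw [hp0, zero_mul])
  · push Not at h0
    have hnot : ∀ p : D, (p.1.1 + 1, p.1.2) ∉ D ∧ (p.1.1, p.1.2 + 1) ∉ D ∧
        (p.1.1 + 1, p.1.2 + 1) ∉ D := fun p => by
      have := Finset.HasAntidiagonal.mem_antidiagonal.1 p.2
      simp only [hD, Finset.HasAntidiagonal.mem_antidiagonal]
      omega
    let f : (p : D) → Sign p.1.2 → ℝ := fun p κ =>
      Ubwd t s (v (p.1.1 + 1)) (u (p.1.2 + 1)) (a (p.1.1 + 1) (p.1.2 + 1)) κ (a (p.1.1 + 1) p.1.2)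
        (a p.1.1 (p.1.2 + 1))
    have hf : ∀ τ (p : D), squareBwd t s u v (patch D τ a) p.1 = f p (τ p) := fun τ p => by
      obtain ⟨h1, h2, h3⟩ := hnot p
      rw [squareBwd, patch_of_mem (x := p.1.1) (y := p.1.2) p.2, patch_of_notMem h1,
        patch_of_notMem h2, patch_of_notMem h3]
    have hsum : HasSum (fun τ => ∏ p ∈ D, squareBwd t s u v (patch D τ a) p) 1 := by
      have h1 : ∀ τ, ∏ p ∈ D, squareBwd t s u v (patch D τ a) p = ∏ p : D, f p (τ p) := fun τ => by
        rw [← Finset.prod_coe_sort]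
        exact Finset.prod_congr rfl fun p _ => hf τ p
      simp_rw [h1]
      -- Each backward law has finite support, so the sum of products is a product of finite sums.
      have h2 : ∑ τ ∈ Fintype.piFinset fun p : D =>
          Sign.below p.1.2 ((a (p.1.1 + 1) (p.1.2 + 1)).1 0 + 1), ∏ p : D, f p (τ p) = 1 := by
        rw [← Finset.prod_univ_sum]
        refine Finset.prod_eq_one fun p _ => ?_
        obtain ⟨h1, h2, -⟩ := huv (p.1.2 + 1) (p.1.1 + 1) (by omega) (by omega)
        exact sum_Ubwd ht0 ht1 hs0 hs1 h1 h2 (h0 p.1 p.2)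
      rw [← h2]
      refine hasSum_sum_of_ne_finset_zero fun τ hτ => ?_
      rw [Fintype.mem_piFinset] at hτ
      push Not at hτ
      obtain ⟨p, hp⟩ := hτ
      refine Finset.prod_eq_zero (Finset.mem_univ p) ?_
      by_contra hne
      exact hp (mem_below_of_Ubwd_ne_zero hne)
    simpa only [Finset.prod_mul_distrib, mul_one] using hsum.mul_left (∏ p ∈ D, upperWeight t s u v a p)

/-- Induction on the staircase: forward moves add the new antidiagonal, reversibility replaces them
by backward moves, and summing out the old antidiagonal removes those. The indicator records the
deterministic left boundary. -/
theorem staircase_law (ht0 : 0 ≤ t) (ht1 : t < 1) (hs0 : -1 < s) (hs1 : s ≤ 0)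
    (huv : ∀ i j : ℕ, 1 ≤ i → 1 ≤ j → 0 ≤ u i ∧ u i < v j ∧ v j < 1)
    (hΛ : IsYangBaxterField t s u v P Λ) (m : ℕ) :
    ∃ Z : ℝ, ∀ a : SignArray, P.real (agree Λ a (staircase m)) =
      Z * (if a 0 (m + 1) = Sign.zero (m + 1) then 1 else 0) *
        ∏ p ∈ Finset.HasAntidiagonal.antidiagonal m, lowerWeight t s u v a p := by
  have hu : ∀ y, 0 ≤ u (y + 1) := fun y => (huv (y + 1) 1 (by omega) le_rfl).1
  have hv : ∀ x, 0 < v (x + 1) := fun x => by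
    obtain ⟨h1, h2, -⟩ := huv 1 (x + 1) le_rfl (by omega)
    exact h1.trans_lt h2
  have hzero : ∀ (y : ℕ) (J : Set (ℕ × ℕ)) (a : SignArray), (0, y) ∈ J → a 0 y ≠ Sign.zero y →
      P.real (agree Λ a J) = 0 := by
    intro y J a hJ ha
    rw [measureReal_eq_zero_iff, ← nonpos_iff_eq_zero, ← ae_iff.1 (hΛ.boundary y)]
    exact measure_mono fun ω hω h => ha ((hω 0 y hJ).symm.trans h)
  induction m with
  | zero =>
    refine ⟨(upWeight t s (u 1) (Sign.zero 0) (Sign.zero 1))⁻¹, fun a => ?_⟩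
    split_ifs with ha
    · have hone : P.real (agree Λ a (staircase 0)) = 1 := by
        have : agree Λ a (staircase 0) =ᵐ[P] Set.univ := by
          rw [Filter.eventuallyEq_univ, mem_ae_iff, ← nonpos_iff_eq_zero,
            ← ae_iff.1 (hΛ.boundary 1)]
          refine measure_mono fun ω hω h => hω fun x y hxy => ?_
          rcases y with _ | _ | y
          · exact Subsingleton.elim _ _
          · obtain rfl : x = 0 := by
              rcases hxy with h | h <;> simp only at h <;> omega
            rw [h]
            exact ha.symm
          · rcases hxy with h | h <;> simp only at h <;> omega
        rw [measureReal_congr this, probReal_univ]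
      have ha0 : a 0 0 = Sign.zero 0 := Subsingleton.elim _ _
      simp [hone, lowerWeight, ha, ha0, rightWeight_empty (hv 0) hs1,
        upWeight_zero_zero_ne_zero ht0 ht1 (hu 0) hs1]
    · rw [hzero 1 _ a (Or.inr rfl) ha]
      simp
  | succ m ih =>
    obtain ⟨Z, hZ⟩ := ih
    let D := Finset.HasAntidiagonal.antidiagonal m
    have hD : ∀ p, p ∈ D ↔ p.1 + p.2 = m := fun p => Finset.HasAntidiagonal.mem_antidiagonal
    -- Upper weights of one antidiagonal share their row weights with lower weights of the next. The
    -- exceptions are the row weight at `x = 0`, which stays as an extra factor, and the one at `y =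
    -- 0`, which is `1`.
    have hprod : ∀ a : SignArray,
        ∏ p ∈ Finset.HasAntidiagonal.antidiagonal (m + 1), lowerWeight t s u v a p =
          upWeight t s (u (m + 2)) (a 0 (m + 1)) (a 0 (m + 2)) * ∏ p ∈ D, upperWeight t s u v a p := by
      intro a
      simp only [lowerWeight, upperWeight, Finset.prod_mul_distrib]
      rw [Finset.Nat.prod_antidiagonal_succ, Finset.Nat.prod_antidiagonal_succ',
        rightWeight_empty (hv _) hs1]
      ring
    refine ⟨Z * (∏ p ∈ D, squareRatio t u v p) *
      (upWeight t s (u (m + 2)) (Sign.zero (m + 1)) (Sign.zero (m + 2)))⁻¹, fun a => ?_⟩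
    split_ifs with ha
    swap
    · rw [hzero (m + 1 + 1) _ a (Or.inr (by simp)) ha]
      simp
    -- Apart from upper corners of squares, the new antidiagonal contains only `(0, m + 2)`, fixed
    -- almost surely, and `(m + 2, 0)`, where the signature is empty.
    have hae : agree Λ a (staircase (m + 1)) =ᵐ[P]
        (agree Λ a {p | p.1 + p.2 = m + 1} ∩ agreeAbove Λ a D : Set Ω) := by
      filter_upwards [hΛ.boundary (m + 2)] with ω hω
      refine propext ⟨fun h => ⟨fun x y hxy => h x y (Or.inl hxy), fun p hp => ?_⟩, ?_⟩
      · refine h _ _ (Or.inr ?_)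
        rw [hD] at hp
        simp only
        omega
      · rintro ⟨h1, h2⟩ x y (hxy | hxy)
        · exact h1 x y hxy
        · simp only at hxy
          rcases x with _ | x
          · obtain rfl : y = m + 2 := by omega
            rw [hω]
            exact ha.symm
          · rcases y with _ | y
            · exact Subsingleton.elim _ _
            · exact h2 (x, y) ((hD _).2 (by simp only; omega))
    have hIJ : ∀ p ∈ D, p ∉ ({p | p.1 + p.2 = m + 1} : Set (ℕ × ℕ)) := fun p hp hp' => by
      rw [hD] at hp
      have : p.1 + p.2 = m + 1 := hp'
      omega
    have hU : ({p | p.1 + p.2 = m + 1} ∪ D : Set (ℕ × ℕ)) = staircase m := by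
      ext p
      simp only [staircase, Set.mem_union, Set.mem_ofPred_eq, Finset.mem_coe, hD]
      omega
    have h1 := hasSum_agree_patch (P := P) hΛ.measurable (a := a) hIJ (agreeAbove Λ a D)
    have h2 := (hasSum_upperWeight_mul_squareBwd ht0 ht1 hs0 hs1 huv m a).mul_left
      (Z * (if a 0 (m + 1) = Sign.zero (m + 1) then 1 else 0) * ∏ p ∈ D, squareRatio t u v p)
    rw [measureReal_congr hae, hprod, h1.unique (Eq.subst (motive := fun F => HasSum F _)
      (funext fun τ => ?_) h2)]
    · by_cases h0 : a 0 (m + 1) = Sign.zero (m + 1)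
      · have := upWeight_zero_zero_ne_zero (N := m + 1) ht0 ht1 (hu (m + 1)) hs1
        rw [ha, h0, if_pos rfl]
        simp only [Nat.add_assoc, Nat.reduceAdd] at this ⊢
        field_simp
        rfl
      -- The indicator for `(0, m + 1)` is absent from the new formula, so the boundary row weight
      -- must vanish in its place.
      · have : upWeight t s (u (m + 2)) (a 0 (m + 1)) (a 0 (m + 2)) = 0 := by
          rw [ha]
          by_contra hne
          exact h0 (eq_zero_of_upWeight_zero_ne_zero (hu (m + 1)) hs1 hne)
        rw [this, if_neg h0]
        simp
    · have hp : ∀ x y, m < x + y → patch D τ a x y = a x y := fun x y hxy =>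
        patch_of_notMem (by rw [hD]; simp only; omega)
      have e1 : agreeAbove Λ a D = agreeAbove Λ (patch D τ a) D := by
        ext ω
        refine forall₂_congr fun p hpS => ?_
        rw [hD] at hpS
        rw [hp _ _ (by omega)]
      have e2 : (∏ p ∈ D, lowerWeight t s u v (patch D τ a) p) *
          ∏ p ∈ D, squareFwd t s u v (patch D τ a) p = (∏ p ∈ D, squareRatio t u v p) *
            ∏ p ∈ D, (upperWeight t s u v a p * squareBwd t s u v (patch D τ a) p) := by
        rw [← Finset.prod_mul_distrib, ← Finset.prod_mul_distrib]
        refine Finset.prod_congr rfl fun p hpS => ?_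
        have hpS' := (hD p).1 hpS
        rw [lowerWeight_mul_squareFwd ht0 ht1 hs0 hs1 huv, ← mul_assoc]
        congr 2
        simp only [upperWeight]
        rw [hp _ _ (by omega), hp _ _ (by omega), hp _ _ (by omega)]
      rw [e1, hU, staircase_markov hΛ _ m (Finset.Subset.refl D), hZ, hp _ _ (by omega), mul_assoc,
        mul_assoc _ _ (∏ p ∈ D, squareFwd t s u v (patch D τ a) p), e2]

end Field

/-! ### The joint law at one square. -/

/-- The points of the staircase other than three corners of the square at `(x, y)`. -/
def staircaseRest (x y : ℕ) : Finset (ℕ × ℕ) :=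
  ((Finset.HasAntidiagonal.antidiagonal (x + y)).erase (x, y)) ∪
    (((Finset.HasAntidiagonal.antidiagonal (x + y + 1)).erase (x + 1, y)).erase (x, y + 1))

theorem mem_staircaseRest {x y : ℕ} {p : ℕ × ℕ} : p ∈ staircaseRest x y ↔
    (p.1 + p.2 = x + y ∧ p ≠ (x, y)) ∨
      (p.1 + p.2 = x + y + 1 ∧ p ≠ (x + 1, y) ∧ p ≠ (x, y + 1)) := by
  simp only [staircaseRest, Finset.mem_union, Finset.mem_erase,
    Finset.HasAntidiagonal.mem_antidiagonal]
  tauto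

/-- An array with given values at the corners of the square at `(x, y)`. -/
def squareArray (x y : ℕ) (kap lam : Sign y) (mu nu : Sign (y + 1)) : SignArray :=
  setAt (setAt (setAt (setAt (fun _ y => Sign.zero y) x y kap) (x + 1) y lam) x (y + 1) mu)
    (x + 1) (y + 1) nu

section squareArray

variable {x y : ℕ} {kap lam : Sign y} {mu nu : Sign (y + 1)}

theorem squareArray_nu : squareArray x y kap lam mu nu (x + 1) (y + 1) = nu := setAt_self _ _ _ _

theorem squareArray_mu : squareArray x y kap lam mu nu x (y + 1) = mu := by
  rw [squareArray, setAt_of_ne _ _ (by omega), setAt_self]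

theorem squareArray_lam : squareArray x y kap lam mu nu (x + 1) y = lam := by
  rw [squareArray, setAt_of_ne _ _ (by omega), setAt_of_ne _ _ (by omega), setAt_self]

theorem squareArray_kap : squareArray x y kap lam mu nu x y = kap := by
  rw [squareArray, setAt_of_ne _ _ (by omega), setAt_of_ne _ _ (by omega),
    setAt_of_ne _ _ (by omega), setAt_self]

theorem squareArray_congr (kap' : Sign y) {x' y' : ℕ} (h : ¬(x' = x ∧ y' = y)) :
    squareArray x y kap lam mu nu x' y' = squareArray x y kap' lam mu nu x' y' := by
  simp only [squareArray, setAt]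
  rw [dif_neg h, dif_neg h]

end squareArray

theorem agree_squareArray {Ω : Type*} (Λ : (x y : ℕ) → Ω → Sign y) (x y : ℕ) (kap lam : Sign y) (mu nu : Sign (y + 1)) :
    agree Λ (squareArray x y kap lam mu nu) {(x, y), (x + 1, y), (x, y + 1)} ∩
        agreeAbove Λ (squareArray x y kap lam mu nu) {(x, y)} =
      {ω | Λ (x + 1) y ω = lam ∧ Λ x (y + 1) ω = mu ∧ Λ (x + 1) (y + 1) ω = nu} ∩
        {ω | Λ x y ω = kap} := by
  ext ω
  simp only [agree, agreeAbove, Set.mem_inter_iff, Set.mem_ofPred_eq, Set.mem_insert_iff,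
    Set.mem_singleton_iff, Finset.mem_singleton, Prod.mk.injEq]
  constructor
  · rintro ⟨h1, h2⟩
    have e1 := h1 x y (by simp)
    have e2 := h1 (x + 1) y (by simp)
    have e3 := h1 x (y + 1) (by simp)
    have e4 := h2 _ rfl
    simp only [squareArray_kap, squareArray_lam, squareArray_mu, squareArray_nu] at e1 e2 e3 e4
    exact ⟨⟨e2, e3, e4⟩, e1⟩
  · rintro ⟨⟨e2, e3, e4⟩, e1⟩
    refine ⟨?_, ?_⟩
    · rintro x' y' (⟨rfl, rfl⟩ | ⟨rfl, rfl⟩ | ⟨rfl, rfl⟩)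
      · rw [squareArray_kap, e1]
      · rw [squareArray_lam, e2]
      · rw [squareArray_mu, e3]
    · rintro _ rfl
      rw [squareArray_nu, e4]

section Field

variable {Ω : Type*} [MeasurableSpace Ω] {P : Measure Ω} [IsProbabilityMeasure P]
  {Λ : (x y : ℕ) → Ω → Sign y} {t s : ℝ} {u v : ℕ → ℝ}

/-- The joint law of the corners of a square and of the rest of the staircase, as a function of the
lower left corner. -/
theorem joint_law (ht0 : 0 ≤ t) (ht1 : t < 1) (hs0 : -1 < s) (hs1 : s ≤ 0)
    (huv : ∀ i j : ℕ, 1 ≤ i → 1 ≤ j → 0 ≤ u i ∧ u i < v j ∧ v j < 1)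
    (hΛ : IsYangBaxterField t s u v P Λ) (x y : ℕ) (lam : Sign y) (mu nu : Sign (y + 1))
    (τ : (p : staircaseRest x y) → Sign p.1.2) :
    ∃ C : ℝ, ∀ kap : Sign y,
      P.real ({ω | Λ (x + 1) y ω = lam ∧ Λ x (y + 1) ω = mu ∧ Λ (x + 1) (y + 1) ω = nu} ∩
          {ω | Λ x y ω = kap} ∩
          (fun ω (p : staircaseRest x y) => Λ p.1.1 p.1.2 ω) ⁻¹' {τ}) =
        C * (upWeight t s (u (y + 1)) lam nu * rightWeight t s (v (x + 1)) nu mu) *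
          Ubwd t s (v (x + 1)) (u (y + 1)) nu kap lam mu := by
  obtain ⟨Z, hZ⟩ := staircase_law ht0 ht1 hs0 hs1 huv hΛ (x + y)
  let A : Sign y → SignArray := fun kap =>
    patch (staircaseRest x y) τ (squareArray x y kap lam mu nu)
  have hA : ∀ kap {x' y' : ℕ}, ¬(x' = x ∧ y' = y) → A kap x' y' = A (Sign.zero y) x' y' := by
    intro kap x' y' h
    simp only [A, patch, squareArray_congr (kap := kap) (Sign.zero y) h]
  have hIJ : ∀ p ∈ staircaseRest x y, p ∉ ({(x, y), (x + 1, y), (x, y + 1)} : Set (ℕ × ℕ)) := by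
    rintro p hp (rfl | rfl | rfl) <;> rw [mem_staircaseRest] at hp <;> simp at hp
  have hU : ({(x, y), (x + 1, y), (x, y + 1)} ∪ staircaseRest x y : Set (ℕ × ℕ)) =
      staircase (x + y) := by
    ext ⟨x', y'⟩
    simp only [staircase, Set.mem_union, Finset.mem_coe, mem_staircaseRest, Set.mem_insert_iff,
      Set.mem_singleton_iff, Set.mem_ofPred_eq, Prod.mk.injEq, ne_eq]
    omega
  have hkap : ∀ kap, A kap x y = kap := fun kap =>
    (patch_of_notMem (by simp [mem_staircaseRest])).trans squareArray_kap
  have hlam : ∀ kap, A kap (x + 1) y = lam := fun kap =>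
    (patch_of_notMem (by simp [mem_staircaseRest])).trans squareArray_lam
  have hmu : ∀ kap, A kap x (y + 1) = mu := fun kap =>
    (patch_of_notMem (by simp [mem_staircaseRest])).trans squareArray_mu
  have hnu : ∀ kap, A kap (x + 1) (y + 1) = nu := fun kap =>
    (patch_of_notMem (by rw [mem_staircaseRest]; simp only; omega)).trans squareArray_nu
  have hmem : (x, y) ∈ Finset.HasAntidiagonal.antidiagonal (x + y) :=
    Finset.HasAntidiagonal.mem_antidiagonal.2 rfl
  refine ⟨Z * (if A (Sign.zero y) 0 (x + y + 1) = Sign.zero (x + y + 1) then 1 else 0) *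
    (∏ p ∈ (Finset.HasAntidiagonal.antidiagonal (x + y)).erase (x, y),
      lowerWeight t s u v (A (Sign.zero y)) p) * squareRatio t u v (x, y), fun kap => ?_⟩
  -- A lower weight involves just one point of the lower antidiagonal, its own corner; the factors
  -- away from `(x, y)` are therefore independent of `kap`.
  have hprod : ∏ p ∈ (Finset.HasAntidiagonal.antidiagonal (x + y)).erase (x, y),
      lowerWeight t s u v (A (Sign.zero y)) p =
        ∏ p ∈ (Finset.HasAntidiagonal.antidiagonal (x + y)).erase (x, y),
          lowerWeight t s u v (A kap) p := by
    refine Finset.prod_congr rfl fun p hp => ?_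
    rw [Finset.mem_erase, Finset.HasAntidiagonal.mem_antidiagonal] at hp
    have hne : ¬(p.1 = x ∧ p.2 = y) := fun h => hp.1 (Prod.ext h.1 h.2)
    simp only [lowerWeight]
    rw [hA kap hne, hA kap (by omega : ¬(p.1 = x ∧ p.2 + 1 = y)),
      hA kap (by omega : ¬(p.1 + 1 = x ∧ p.2 = y))]
  have habove : agreeAbove Λ (squareArray x y kap lam mu nu) {(x, y)} =
      agreeAbove Λ (A kap) {(x, y)} := by
    simp only [agreeAbove, Finset.mem_singleton, forall_eq, hnu, squareArray_nu]
  have hlow := lowerWeight_mul_squareFwd ht0 ht1 hs0 hs1 huv (A kap) (x, y)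
  simp only [upperWeight, squareBwd, hkap, hlam, hmu, hnu] at hlow
  rw [← agree_squareArray, Set.inter_right_comm, agree_inter_preimage hIJ, hU, habove,
    show patch (staircaseRest x y) τ (squareArray x y kap lam mu nu) = A kap from rfl,
    staircase_markov hΛ _ _ (Finset.singleton_subset_iff.2 hmem), Finset.prod_singleton, hZ,
    hA kap (by omega), ← Finset.mul_prod_erase _ _ hmem, hprod]
  linear_combination (Z * (if A (Sign.zero y) 0 (x + y + 1) = Sign.zero (x + y + 1) then 1 else 0) *
    (∏ p ∈ (Finset.HasAntidiagonal.antidiagonal (x + y)).erase (x, y),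
      lowerWeight t s u v (A kap) p)) * hlow

end Field

end YangBaxter

end

theorem mainTheorem9 (t s : ℝ) (ht0 : 0 ≤ t) (ht1 : t < 1) (hs0 : -1 < s) (hs1 : s ≤ 0)
    (u v : ℕ → ℝ)
    (huv : ∀ i j : ℕ, 1 ≤ i → 1 ≤ j → 0 ≤ u i ∧ u i < v j ∧ v j < 1)
    {Ω : Type*} [MeasurableSpace Ω] (P : Measure Ω) [IsProbabilityMeasure P]
    (Λ : (x y : ℕ) → Ω → YangBaxter.Sign y)
    (hΛ : YangBaxter.IsYangBaxterField t s u v P Λ)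
    (x y : ℕ) (lam : YangBaxter.Sign y) (mu nu : YangBaxter.Sign (y + 1))
    (hpos : P {ω | Λ (x + 1) y ω = lam ∧ Λ x (y + 1) ω = mu ∧ Λ (x + 1) (y + 1) ω = nu} ≠ 0)
    (kap : YangBaxter.Sign y) :
    (P[|{ω | Λ (x + 1) y ω = lam ∧ Λ x (y + 1) ω = mu ∧ Λ (x + 1) (y + 1) ω = nu}]).real
        {ω | Λ x y ω = kap} =
      YangBaxter.Ubwd t s (v (x + 1)) (u (y + 1)) nu kap lam mu := by
  open YangBaxter in
  set A := {ω | Λ (x + 1) y ω = lam ∧ Λ x (y + 1) ω = mu ∧ Λ (x + 1) (y + 1) ω = nu} with hA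
  obtain ⟨hu, huv', -⟩ := huv (y + 1) (x + 1) (by omega) (by omega)
  let X : Ω → (p : staircaseRest x y) → Sign p.1.2 := fun ω p => Λ p.1.1 p.1.2 ω
  have hX : Measurable X := measurable_pi_lambda _ fun p => hΛ.measurable p.1.1 p.1.2
  -- With the rest of the staircase fixed, summing `joint_law` over the lower left corner identifies
  -- its prefactor as the probability of `A ∩ X ⁻¹' {τ}`.
  have hcond : ∀ τ, P.real (A ∩ {ω | Λ x y ω = kap} ∩ X ⁻¹' {τ}) =
      P.real (A ∩ X ⁻¹' {τ}) * Ubwd t s (v (x + 1)) (u (y + 1)) nu kap lam mu := by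
    intro τ
    obtain ⟨C, hC⟩ := joint_law ht0 ht1 hs0 hs1 huv hΛ x y lam mu nu τ
    have h1 := hasSum_measureReal_inter_preimage P (hΛ.measurable x y) (A ∩ X ⁻¹' {τ})
    have h2 : HasSum (fun k => P.real (A ∩ X ⁻¹' {τ} ∩ Λ x y ⁻¹' {k}))
        (C * (upWeight t s (u (y + 1)) lam nu * rightWeight t s (v (x + 1)) nu mu)) := by
      have h3 : ∀ k, P.real (A ∩ X ⁻¹' {τ} ∩ Λ x y ⁻¹' {k}) =
          C * (upWeight t s (u (y + 1)) lam nu * rightWeight t s (v (x + 1)) nu mu) *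
            Ubwd t s (v (x + 1)) (u (y + 1)) nu k lam mu := fun k => by
        rw [Set.inter_right_comm]
        exact hC k
      simp_rw [h3]
      -- `sum_Ubwd` needs a nonzero weight; when the weight is zero, every term and the claimed sum
      -- are zero.
      by_cases h0 : upWeight t s (u (y + 1)) lam nu * rightWeight t s (v (x + 1)) nu mu = 0
      · simp [h0, hasSum_zero]
      · nth_rewrite 2 [← mul_one (C * _)]
        refine HasSum.mul_left _ ?_
        rw [← sum_Ubwd ht0 ht1 hs0 hs1 hu huv' h0]
        refine hasSum_sum_of_ne_finset_zero fun k hk => ?_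
        by_contra hne
        exact hk (mem_below_of_Ubwd_ne_zero hne)
    rw [h1.unique h2]
    exact hC kap
  have h1 := hasSum_measureReal_inter_preimage P hX (A ∩ {ω | Λ x y ω = kap})
  simp_rw [hcond] at h1
  have h2 := h1.unique ((hasSum_measureReal_inter_preimage P hX A).mul_right _)
  have hm : MeasurableSet A :=
    (hΛ.measurable (x + 1) y (measurableSet_singleton lam)).inter
      ((hΛ.measurable x (y + 1) (measurableSet_singleton mu)).inter
        (hΛ.measurable (x + 1) (y + 1) (measurableSet_singleton nu)))
  rw [measureReal_def, cond_apply hm, ENNReal.toReal_mul, ENNReal.toReal_inv, ← measureReal_def,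
    ← measureReal_def, h2, ← mul_assoc, inv_mul_cancel₀, one_mul]
  exact ENNReal.toReal_ne_zero.2 ⟨hpos, by finiteness⟩
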